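/- Let $\Omega\subset\mathbb{C}^2$ be a pseudoconvex domain with smooth boundary $b\Omega$ ($\Omega$ is open and connected, but need not be bounded), and let $p_0\in b\Omega$ be a point of type $4$. A smooth local defining function for $\Omega$ near $p_0$ is a $\mathcal{C}^\infty$ function $r\colon U\to\mathbb{R}$ on an open neighborhood $U$ of $p_0$ such that $\Omega\cap U=\{r<0\}$ and $dr\neq 0$ on $b\Omega\cap U$. Write $H_r(\xi,\xi)=\sum_{j,k}\frac{\partial^2 r}{\partial z^j\partial\bar z^k}\xi^j\bar\xi^k$ for $\xi\in\mathbb{C}^2$. Type $4$ means the following: if $L$ is a nonvanishing smooth $(1,0)$ vector field near $p_0$ that is tangential to $b\Omega$, and $\lambda=H_r(L,L)|_{b\Omega}$ is the Levi form, then $\lambda$ and its first derivatives $L\lambda,\bar L\lambda$ vanish at $p_0$, while at least one of the second derivatives $LL\lambda$, $L\bar L\lambda$, $\bar LL\lambda$, $\bar L\bar L\lambda$ does not vanish at $p_0$ (this does not depend on the choice of $r$ and $L$). Suppose that $\Omega$ admits a smooth local defining function $r$ near $p_0$ which is plurisubharmonic on $b\Omega$ near $p_0$, i.e. $H_r(\xi,\xi)(q)\ge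 0$ for all $\xi\in\mathbb{C}^2$ and all $q\in b\Omega$ sufficiently close to $p_0$. Then $\Omega$ admits a smooth local defining function $\rho\colon V\to\mathbb{R}$ near $p_0$ which is plurisubharmonic on the whole neighborhood $V$ of $p_0$, i.e. $H_\rho(\xi,\xi)(q)\ge 0$ for all $\xi\in\mathbb{C}^2$ and all $q\in V$. -/

import Mathlib

open scoped ContDiff Topology ComplexConjugate

noncomputable section

/-- The complex Euclidean space of dimension `n`. -/
abbrev CSpace (n : ℕ) : Type := EuclideanSpace ℂ (Fin n)

/-- The Wirtinger derivative `∂f/∂z^j = (∂f/∂x^j - i ∂f/∂y^j) / 2`. -/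
def dz {n : ℕ} (j : Fin n) (f : CSpace n → ℂ) (p : CSpace n) : ℂ :=
  (1 / 2 : ℂ) * (fderiv ℝ f p (EuclideanSpace.single j (1 : ℂ))
    - Complex.I * fderiv ℝ f p (EuclideanSpace.single j Complex.I))

/-- The Wirtinger derivative `∂f/∂z̄^j = (∂f/∂x^j + i ∂f/∂y^j) / 2`. -/
def dzbar {n : ℕ} (j : Fin n) (f : CSpace n → ℂ) (p : CSpace n) : ℂ :=
  (1 / 2 : ℂ) * (fderiv ℝ f p (EuclideanSpace.single j (1 : ℂ))
    + Complex.I * fderiv ℝ f p (EuclideanSpace.single j Complex.I))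

/-- The complex Hessian form
`H_r(ξ, η)(p) = ∑ j k, (∂²r/∂z^j∂z̄^k)(p) ξ^j conj(η^k)` of a real function `r`. -/
def complexHessian {n : ℕ} (r : CSpace n → ℝ) (p ξ η : CSpace n) : ℂ :=
  ∑ j : Fin n, ∑ k : Fin n,
    dz j (dzbar k (fun q => (r q : ℂ))) p * ξ j * conj (η k)

/-- The pairing `⟨∂r, ξ⟩(p) = ∑ j, (∂r/∂z^j)(p) ξ^j`. -/
def delPairing {n : ℕ} (r : CSpace n → ℝ) (p ξ : CSpace n) : ℂ :=
  ∑ j : Fin n, dz j (fun q => (r q : ℂ)) p * ξ j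

/-- `r : U → ℝ` is a smooth local defining function for `Ω` near `p`. (Values of `r` outside of
the open set `U` are irrelevant.) -/
structure IsLocalDefiningFunction {n : ℕ} (Ω : Set (CSpace n)) (p : CSpace n)
    (U : Set (CSpace n)) (r : CSpace n → ℝ) : Prop where
  isOpen : IsOpen U
  mem : p ∈ U
  smooth : ContDiffOn ℝ ∞ r U
  inter_eq : Ω ∩ U = {q ∈ U | r q < 0}
  fderiv_ne_zero : ∀ q ∈ frontier Ω ∩ U, fderiv ℝ r q ≠ 0

/-- A (not necessarily bounded) domain with smooth boundary. -/
structure IsSmoothlyBoundedDomain {n : ℕ} (Ω : Set (CSpace n)) : Prop where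
  isOpen : IsOpen Ω
  isConnected : IsConnected Ω
  exists_localDefiningFunction :
    ∀ p ∈ frontier Ω, ∃ U r, IsLocalDefiningFunction Ω p U r

/-- The smooth vector field `L = ∑ j, L^j ∂/∂z^j` of type `(1,0)` on `U`, given by its coefficients,
is tangential to the boundary of `Ω`; here `r : U → ℝ` is a local defining function. -/
structure IsTangentialField {n : ℕ} (Ω U : Set (CSpace n)) (r : CSpace n → ℝ)
    (L : CSpace n → CSpace n) : Prop where
  smooth : ContDiffOn ℝ ∞ L U
  tangential : ∀ q ∈ frontier Ω ∩ U, delPairing r q (L q) = 0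

/-- `Ω` is pseudoconvex at the boundary point `p`. (The number `H_r(ξ, ξ)(q)` is real.) -/
def IsPseudoconvexAt {n : ℕ} (Ω : Set (CSpace n)) (p : CSpace n) : Prop :=
  ∃ U r, IsLocalDefiningFunction Ω p U r ∧
    ∀ L, IsTangentialField Ω U r L →
      ∀ᶠ q in 𝓝[frontier Ω] p, 0 ≤ (complexHessian r q (L q) (L q)).re

/-- `Ω` is pseudoconvex at all its boundary points. -/
def IsPseudoconvex {n : ℕ} (Ω : Set (CSpace n)) : Prop :=
  ∀ p ∈ frontier Ω, IsPseudoconvexAt Ω p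

/-- The complex Hessian form of `r` is positive semi-definite at `q`. -/
def IsPshAtPoint {n : ℕ} (r : CSpace n → ℝ) (q : CSpace n) : Prop :=
  ∀ ξ : CSpace n, 0 ≤ (complexHessian r q ξ ξ).re

/-- The smooth function `r` is plurisubharmonic on the open set `U`. -/
def IsPshOn {n : ℕ} (r : CSpace n → ℝ) (U : Set (CSpace n)) : Prop :=
  ∀ q ∈ U, IsPshAtPoint r q

/-- The function `r` is plurisubharmonic on the boundary of `Ω` near `p`. -/
def IsPshOnBoundaryNear {n : ℕ} (Ω : Set (CSpace n)) (p : CSpace n)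
    (r : CSpace n → ℝ) : Prop :=
  ∀ᶠ q in 𝓝[frontier Ω] p, IsPshAtPoint r q

/-- The derivative `L f = ∑ j, L^j ∂f/∂z^j`. -/
def applyField {n : ℕ} (L : CSpace n → CSpace n) (f : CSpace n → ℂ) (p : CSpace n) : ℂ :=
  ∑ j : Fin n, L p j * dz j f p

/-- The derivative `L̄ f = ∑ j, conj(L^j) ∂f/∂z̄^j`. -/
def applyConjField {n : ℕ} (L : CSpace n → CSpace n) (f : CSpace n → ℂ) (p : CSpace n) : ℂ :=
  ∑ j : Fin n, conj (L p j) * dzbar j f p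

/-- Iterated derivatives of `f` along fields from `{L, L̄}`: a word is a list of Booleans, in which
`true` stands for `L` and `false` for `L̄`; the head of the list is applied last. -/
def applyWord {n : ℕ} (L : CSpace n → CSpace n) : List Bool → (CSpace n → ℂ) → CSpace n → ℂ
  | [], f => f
  | true :: w, f => applyField L (applyWord L w f)
  | false :: w, f => applyConjField L (applyWord L w f)

/-- The boundary of `Ω ⊆ ℂ²` is of finite type `k` at `p`: for a local defining function `r` and
a nonvanishing tangential field `L` of type `(1,0)` near `p`, the number `k` is the smallest integer
for which some derivative of order `k - 2` of the Levi form `λ = H_r(L, L)` along fields from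
`{L, L̄}` does not vanish at `p`. Since `L` and `L̄` are tangential, these derivatives at `p` depend
on the restriction of `λ` to the boundary of `Ω` only. -/
def HasType (Ω : Set (CSpace 2)) (p : CSpace 2) (k : ℕ) : Prop :=
  ∃ U r L, IsLocalDefiningFunction Ω p U r ∧ IsTangentialField Ω U r L ∧ (∀ q ∈ U, L q ≠ 0) ∧
    (∃ w : List Bool, w.length + 2 = k ∧
      applyWord L w (fun q => complexHessian r q (L q) (L q)) p ≠ 0) ∧
    ∀ w : List Bool, w.length + 2 < k →
      applyWord L w (fun q => complexHessian r q (L q) (L q)) p = 0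

end

/-!
Let `r` be a defining function whose complex Hessian is semidefinite on the boundary `b`, let `L` be
a field which is complex tangential to all level sets of `r`, and let `λ = H_r(L, L)` be the Levi
form. Off the boundary, semidefiniteness of `r` can fail to first order in `r` only in the direction
of `L`, because the normal derivative of `λ` may have the wrong sign. Directions transversal to `L`
are repaired by adding a large multiple of `r ^ 2`, since the mixed terms `H_r(L, ·)` are `O(√λ)` on
`b` by the Cauchy-Schwarz inequality.

In order to remove the first order term, `r` is multiplied by `H = 1 + μ F`, where `F` is a function
that agrees on `b` with a positive multiple of `λ`. As `L r = 0`, the normal derivative of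
`H_{rH}(L, L)` at the boundary is that of `λ` plus `μ H_F(L, L)`, up to terms containing `F` or a
tangential derivative of `F`. Both are `O(√λ)`, the latter by Glaeser's inequality for functions
which are nonnegative on `b` (`exists_sq_fderiv_le_of_nonneg_on_zeros`). So `μ` can be chosen as a
quotient with denominator `H_F(L, L)` (`IsTangentFrame.exists_multiplier`), and what remains of the
first order term is `O(|r| √λ)`, which is absorbed by `λ` and `r ^ 2`. A final term `M r ^ 2 g`, with
`g` a square vanishing at the base point, gives a gain of order `r ^ 2` in the direction of `L`
(`IsTangentFrame.exists_psh_multiple`).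

The type condition enters through `H_F(L, L) ≠ 0` at the base point. Here `F` is the Levi form with
respect to the defining function and the tangential field from the definition of the type. Since `F`
is nonnegative on `b` and vanishes at the base point, its second derivatives in complex tangential
directions form, after subtraction of a multiple of `r`, a semidefinite form with trace
`4 H_F(L, L)`. If this trace vanished, all derivatives of order two of `F` along `L` and its
conjugate would vanish (`fderiv_fderiv_apply_eq_zero`), and the type would exceed four.
-/

open Filter Metric Asymptotics

/-! ### Functions on the zero set of a defining function -/

section RealAnalysis

variable {E : Type*} [NormedAddCommGroup E] [NormedSpace ℝ E]

lemma exists_abs_sub_fderiv_le {f : E → ℝ} {p : E} (hf : ContDiffAt ℝ 2 f p) :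
    ∃ C > 0, ∃ V ∈ 𝓝 p, ∀ x ∈ V, ∀ y ∈ V,
      |f y - f x - fderiv ℝ f x (y - x)| ≤ C * ‖y - x‖ ^ 2 := by
  obtain ⟨K, t, ht, hK⟩ :=
    (hf.fderiv_right (m := 1) (by norm_num)).exists_lipschitzOnWith
  have hd : ∀ᶠ x in 𝓝 p, DifferentiableAt ℝ f x :=
    (hf.eventually (by simp)).mono fun x hx => hx.differentiableAt (by simp)
  obtain ⟨ε, hε, hball⟩ := Metric.mem_nhds_iff.1 (Filter.inter_mem ht hd)
  refine ⟨K + 1, by positivity, ball p ε, ball_mem_nhds p hε, fun x hx y hy => ?_⟩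
  have hseg : segment ℝ x y ⊆ ball p ε := (convex_ball p ε).segment_subset hx hy
  have key := (convex_segment (𝕜 := ℝ) x y).norm_image_sub_le_of_norm_fderiv_le' (f := f)
    (φ := fderiv ℝ f x) (C := K * ‖y - x‖)
    (fun z hz => (hball (hseg hz)).2) (fun z hz => ?_)
    (left_mem_segment ℝ x y) (right_mem_segment ℝ x y)
  · rw [Real.norm_eq_abs] at key
    nlinarith [sq_nonneg ‖y - x‖]
  · have h1 := hK.norm_sub_le (hball (hseg hz)).1 (hball hx).1
    refine h1.trans ?_
    gcongr
    exact norm_sub_le_of_mem_segment hz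

lemma exists_abs_sub_le {f : E → ℝ} {p : E} (hf : ContDiffAt ℝ 1 f p) :
    ∃ C > 0, ∃ V ∈ 𝓝 p, ∀ x ∈ V, ∀ y ∈ V, |f y - f x| ≤ C * ‖y - x‖ := by
  obtain ⟨K, t, ht, hK⟩ := hf.exists_lipschitzOnWith
  refine ⟨K + 1, by positivity, t, ht, fun x hx y hy => ?_⟩
  have := hK.norm_sub_le hy hx
  rw [Real.norm_eq_abs] at this
  nlinarith [norm_nonneg (y - x)]

/-- A function that increases along `u` at its zero `p` has, on the line in direction `u` through any
point `q` near `p`, a zero at distance `O(|r q|)` from `q`. -/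
lemma exists_zero_on_line {r : E → ℝ} {p u : E} (hr : ContDiffAt ℝ 1 r p)
    (h0 : r p = 0) (hu : 0 < fderiv ℝ r p u) :
    ∃ C > 0, ∀ V ∈ 𝓝 p, ∀ᶠ q in 𝓝 p,
      ∃ s : ℝ, |s| ≤ C * |r q| ∧ r (q - s • u) = 0 ∧ q - s • u ∈ V := by
  have hu0 : 0 < ‖u‖ := by
    rw [norm_pos_iff]; rintro rfl; simp at hu
  set c : ℝ := fderiv ℝ r p u / 2 with hc
  have hcpos : 0 < c := by positivity
  refine ⟨c⁻¹, by positivity, fun V hV => ?_⟩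
  have hlo := (hr.hasStrictFDerivAt (by simp)).isLittleO.def (c := c / ‖u‖) (by positivity)
  rw [nhds_prod_eq, eventually_prod_iff] at hlo
  obtain ⟨P, hP, Q, hQ, hPQ⟩ := hlo
  have hcont : ∀ᶠ q in 𝓝 p, ContinuousAt r q :=
    (hr.eventually (by simp)).mono fun x hx => hx.continuousAt
  obtain ⟨ε, hε, hball⟩ := Metric.mem_nhds_iff.1
    (Filter.inter_mem (Filter.inter_mem hV hcont) (Filter.inter_mem hP hQ))
  have hrq : Tendsto (fun q => |r q|) (𝓝 p) (𝓝 0) := by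
    have := hr.continuousAt.tendsto.abs
    simpa [h0] using this
  filter_upwards [ball_mem_nhds p (half_pos hε),
    hrq.eventually (gt_mem_nhds (show 0 < ε / 2 * c / ‖u‖ by positivity))] with q hq hrq'
  have hmem : ∀ s : ℝ, |s| ≤ c⁻¹ * |r q| → q - s • u ∈ ball p ε := by
    intro s hs
    have h1 : ‖s • u‖ < ε / 2 := by
      rw [norm_smul, Real.norm_eq_abs]
      calc |s| * ‖u‖ ≤ c⁻¹ * |r q| * ‖u‖ := by gcongr
        _ < c⁻¹ * (ε / 2 * c / ‖u‖) * ‖u‖ := by gcongr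
        _ = ε / 2 := by field_simp
    rw [mem_ball_iff_norm] at hq ⊢
    calc ‖q - s • u - p‖ = ‖(q - p) - s • u‖ := by congr 1; abel
      _ ≤ ‖q - p‖ + ‖s • u‖ := norm_sub_le _ _
      _ < ε := by linarith
  have hest : ∀ s : ℝ, |s| ≤ c⁻¹ * |r q| → |r (q - s • u) - r q + s * (2 * c)| ≤ c * |s| := by
    intro s hs
    have h := hPQ (hball (hmem s hs)).2.1 (hball (hmem 0 (by simp; positivity))).2.2
    simp only [zero_smul, sub_zero] at h
    have e : q - s • u - q = -(s • u) := by abel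
    rw [e, norm_neg, norm_smul, map_neg, map_smul, smul_eq_mul, Real.norm_eq_abs,
      Real.norm_eq_abs] at h
    have e2 : c / ‖u‖ * (|s| * ‖u‖) = c * |s| := by field_simp
    rw [e2] at h
    convert h using 2
    rw [hc]; ring
  set a : ℝ := c⁻¹ * |r q| with ha
  have ha0 : 0 ≤ a := by positivity
  have hca : c * a = |r q| := by rw [ha]; field_simp
  have hcon : ContinuousOn (fun s : ℝ => r (q - s • u)) (Set.Icc (-a) a) := by
    intro s hs
    refine ContinuousAt.continuousWithinAt ?_
    have h1 : ContinuousAt r (q - s • u) := (hball (hmem s (abs_le.2 hs))).1.2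
    exact ContinuousAt.comp (f := fun s : ℝ => q - s • u) h1 (by fun_prop)
  have h1 := hest a (by rw [abs_of_nonneg ha0])
  have h2 := hest (-a) (by rw [abs_neg, abs_of_nonneg ha0])
  rw [abs_neg] at h2
  rw [abs_of_nonneg ha0] at h1 h2
  have h3 := le_abs_self (r q)
  have h4 := neg_abs_le (r q)
  have hivt : (0 : ℝ) ∈ (fun s : ℝ => r (q - s • u)) '' Set.Icc (-a) a := by
    refine intermediate_value_Icc' (by linarith) hcon ⟨?_, ?_⟩
    · have := (abs_le.1 h1).2
      linarith
    · have := (abs_le.1 h2).1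
      linarith
  obtain ⟨s, hs, hs0⟩ := hivt
  exact ⟨s, abs_le.2 hs, hs0, (hball (hmem s (abs_le.2 hs))).1.1⟩

lemma eventually_pos_of_fderiv_pos {r : E → ℝ} {p u : E} (hr : DifferentiableAt ℝ r p)
    (h0 : r p = 0) (hu : 0 < fderiv ℝ r p u) : ∀ᶠ t : ℝ in 𝓝[>] 0, 0 < r (p + t • u) := by
  have hd : HasDerivAt (fun t : ℝ => r (p + t • u)) (fderiv ℝ r p u) 0 := by
    have h1 : HasDerivAt (fun t : ℝ => p + t • u) u 0 := by
      simpa using ((hasDerivAt_id (0 : ℝ)).smul_const u).const_add p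
    have h2 : HasFDerivAt r (fderiv ℝ r p) (p + (0 : ℝ) • u) := by simpa using hr.hasFDerivAt
    exact h2.comp_hasDerivAt 0 h1
  have h := hd.tendsto_slope_zero_right
  filter_upwards [h.eventually (lt_mem_nhds hu), self_mem_nhdsWithin] with t ht ht0
  simp only [zero_add, zero_smul, add_zero, h0, sub_zero, smul_eq_mul] at ht
  exact (pos_iff_pos_of_mul_pos ht).1 (inv_pos.2 ht0)

lemma exists_fderiv_pos {A : E →L[ℝ] ℝ} (h : A ≠ 0) : ∃ u, 0 < A u := by
  obtain ⟨u, hu⟩ := DFunLike.ne_iff.1 h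
  rcases lt_or_gt_of_ne hu with h1 | h1
  · exact ⟨-u, by simpa using h1⟩
  · exact ⟨u, h1⟩

/-- Lagrange multipliers: a function with a local minimum on a level set of `r` has there no
derivative along the level set. -/
lemma fderiv_eq_zero_of_nonneg_on_zeros [CompleteSpace E] {r f : E → ℝ} {p v : E}
    (hr : ContDiffAt ℝ 1 r p) (hf : ContDiffAt ℝ 1 f p) (h0 : r p = 0) (hdr : fderiv ℝ r p ≠ 0)
    (hf0 : f p = 0) (hpos : ∀ᶠ q in 𝓝 p, r q = 0 → 0 ≤ f q) (hv : fderiv ℝ r p v = 0) :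
    fderiv ℝ f p v = 0 := by
  have hext : IsLocalExtrOn f {x | r x = r p} p := by
    refine Or.inl ?_
    change ∀ᶠ q in 𝓝[{x | r x = r p}] p, f p ≤ f q
    rw [eventually_nhdsWithin_iff]
    filter_upwards [hpos] with q hq hq'
    rw [hf0]
    exact hq (by rw [← h0]; exact hq')
  obtain ⟨a, b, hab, h⟩ := hext.exists_multipliers_of_hasStrictFDerivAt_1d
    (hr.hasStrictFDerivAt (by simp)) (hf.hasStrictFDerivAt (by simp))
  have hb : b ≠ 0 := by
    rintro rfl
    have ha : a ≠ 0 := fun ha => hab (by rw [ha]; rfl)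
    simp only [zero_smul, add_zero, smul_eq_zero] at h
    exact h.elim ha hdr
  have := DFunLike.congr_fun h v
  simpa [hv, hb] using this

lemma fderiv_eq_zero_of_eq_zero_on_zeros [CompleteSpace E] {r f : E → ℝ} {p v : E}
    (hr : ContDiffAt ℝ 1 r p) (hf : ContDiffAt ℝ 1 f p) (h0 : r p = 0) (hdr : fderiv ℝ r p ≠ 0)
    (hz : ∀ᶠ q in 𝓝 p, r q = 0 → f q = 0) (hv : fderiv ℝ r p v = 0) :
    fderiv ℝ f p v = 0 :=
  fderiv_eq_zero_of_nonneg_on_zeros hr hf h0 hdr (hz.self_of_nhds h0)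
    (hz.mono fun _ h h' => (h h').ge) hv

lemma fderiv_fderiv_nonneg_of_neg_cube_le {G : E → ℝ} {p v : E} {B : ℝ}
    (hG : ContDiffAt ℝ 2 G p) (hG0 : G p = 0) (hdG : fderiv ℝ G p = 0)
    (hlow : ∀ᶠ t : ℝ in 𝓝 0, -(B * |t| ^ 3) ≤ G (p + t • v)) :
    0 ≤ fderiv ℝ (fderiv ℝ G) p v v := by
  have hline : Tendsto (fun t : ℝ => p + t • v) (𝓝 0) (𝓝 p) := by
    have : ContinuousAt (fun t : ℝ => p + t • v) 0 := by fun_prop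
    simpa [ContinuousAt] using this
  by_contra! hneg
  set κ : ℝ := -fderiv ℝ (fderiv ℝ G) p v v with hκ
  have hκ0 : 0 < κ := by rw [hκ]; linarith
  have hdl : ∀ t : ℝ, HasDerivAt (fun t : ℝ => p + t • v) v t := fun t => by
    simpa using ((hasDerivAt_id t).smul_const v).const_add p
  have hd1 : ∀ᶠ t : ℝ in 𝓝 0, HasDerivAt (fun t : ℝ => -G (p + t • v) - κ / 4 * t ^ 2)
      (-fderiv ℝ G (p + t • v) v - κ / 2 * t) t := by
    filter_upwards [hline.eventually (hG.eventually (by simp))] with t ht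
    have h1 : HasDerivAt (fun t : ℝ => G (p + t • v)) (fderiv ℝ G (p + t • v) v) t :=
      (ht.differentiableAt (by simp)).hasFDerivAt.comp_hasDerivAt t (hdl t)
    have h2 : HasDerivAt (fun t : ℝ => κ / 4 * t ^ 2) (κ / 2 * t) t :=
      ((hasDerivAt_pow 2 t).const_mul (κ / 4)).congr_deriv (by norm_num; ring)
    exact h1.neg.sub h2
  have hd2 : HasDerivAt (fun t : ℝ => -fderiv ℝ G (p + t • v) v - κ / 2 * t)
      (κ - κ / 2) 0 := by
    have hA : HasFDerivAt (fderiv ℝ G) (fderiv ℝ (fderiv ℝ G) p) (p + (0 : ℝ) • v) := by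
      simpa using ((hG.fderiv_right (m := 1) (by norm_num)).differentiableAt (by simp)).hasFDerivAt
    have h1 : HasDerivAt (fun t : ℝ => fderiv ℝ G (p + t • v) v)
        (fderiv ℝ (fderiv ℝ G) p v v) 0 := by
      have h3 : HasDerivAt (fun t : ℝ => fderiv ℝ G (p + t • v)) (fderiv ℝ (fderiv ℝ G) p v) 0 :=
        hA.comp_hasDerivAt 0 (hdl 0)
      exact (ContinuousLinearMap.apply ℝ ℝ v).hasFDerivAt.comp_hasDerivAt 0 h3
    have h2 : HasDerivAt (fun t : ℝ => κ / 2 * t) (κ / 2) 0 :=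
      ((hasDerivAt_id (0 : ℝ)).const_mul (κ / 2)).congr_deriv (by simp)
    exact h1.neg.sub h2
  have hmin : IsLocalMin (fun t : ℝ => -G (p + t • v) - κ / 4 * t ^ 2) 0 := by
    have hde : deriv (fun t : ℝ => -G (p + t • v) - κ / 4 * t ^ 2) =ᶠ[𝓝 0]
        fun t => -fderiv ℝ G (p + t • v) v - κ / 2 * t := hd1.mono fun t ht => ht.deriv
    refine isLocalMin_of_deriv_deriv_pos ?_ ?_ hd1.self_of_nhds.continuousAt
    · rw [hde.deriv_eq, hd2.deriv]; linarith
    · rw [hde.self_of_nhds]; simp [hdG]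
  have hfin : ∀ᶠ t : ℝ in 𝓝 0, B * |t| < κ / 4 := by
    have : Tendsto (fun t : ℝ => B * |t|) (𝓝 0) (𝓝 0) := by
      have : ContinuousAt (fun t : ℝ => B * |t|) 0 := by fun_prop
      simpa [ContinuousAt] using this
    exact this.eventually (gt_mem_nhds (by positivity))
  have hall : ∀ᶠ t : ℝ in 𝓝[≠] 0, False := by
    filter_upwards [nhdsWithin_le_nhds hlow, nhdsWithin_le_nhds hfin, nhdsWithin_le_nhds hmin,
      self_mem_nhdsWithin] with t h1 h2 h3 h4
    simp only [zero_smul, add_zero, hG0, neg_zero, ne_eq, OfNat.ofNat_ne_zero, not_false_eq_true,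
      zero_pow, mul_zero, sub_zero] at h3
    have h5 : 0 < |t| ^ 2 := by
      have : 0 < |t| := abs_pos.2 h4
      positivity
    rw [← sq_abs t] at h3
    nlinarith
  exact (Filter.eventually_false_iff_eq_bot.1 hall |> NeBot.ne inferInstance)

/-- The second order necessary condition for a minimum of `G` on the zero set of `r`, at a critical
point of `G`. -/
lemma fderiv_fderiv_nonneg_of_nonneg_on_zeros {r G : E → ℝ} {p v : E}
    (hr : ContDiffAt ℝ 2 r p) (hG : ContDiffAt ℝ 2 G p) (h0 : r p = 0) (hdr : fderiv ℝ r p ≠ 0)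
    (hG0 : G p = 0) (hdG : fderiv ℝ G p = 0) (hpos : ∀ᶠ q in 𝓝 p, r q = 0 → 0 ≤ G q)
    (hv : fderiv ℝ r p v = 0) : 0 ≤ fderiv ℝ (fderiv ℝ G) p v v := by
  obtain ⟨u, hu⟩ := exists_fderiv_pos hdr
  obtain ⟨C₁, hC₁, hproj⟩ := exists_zero_on_line (hr.of_le (by norm_num)) h0 hu
  obtain ⟨C₂, hC₂, V₂, hV₂, hT₂⟩ := exists_abs_sub_fderiv_le hr
  obtain ⟨C₃, hC₃, V₃, hV₃, hT₃⟩ := exists_abs_sub_fderiv_le hG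
  obtain ⟨K, V₄, hV₄, hK⟩ :=
    (hG.fderiv_right (m := 1) (by norm_num)).exists_lipschitzOnWith
  have hline : Tendsto (fun t : ℝ => p + t • v) (𝓝 0) (𝓝 p) := by
    have : ContinuousAt (fun t : ℝ => p + t • v) 0 := by fun_prop
    simpa [ContinuousAt] using this
  set D : ℝ := C₁ * C₂ * ‖v‖ ^ 2 with hD
  have hD0 : 0 ≤ D := by positivity
  -- On the line `p + t v`, which is tangent to the zero set, `G` is at least of size `-O(|t| ^ 3)`.
  have hlow : ∀ᶠ t : ℝ in 𝓝 0, -((K * ‖v‖ * ‖u‖ * D + C₃ * ‖u‖ ^ 2 * D ^ 2) * |t| ^ 3)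
      ≤ G (p + t • v) := by
    have hV := Filter.inter_mem hpos (Filter.inter_mem hV₃ hV₄)
    filter_upwards [hline.eventually (hproj _ hV), hline.eventually hV₂, hline.eventually hV,
      (Metric.ball_mem_nhds (0 : ℝ) one_pos)] with t ⟨s, hs, hs0, hsV⟩ htV₂ htV ht1
    have ht1 : |t| < 1 := by simpa using ht1
    have hrt : |r (p + t • v)| ≤ C₂ * (‖v‖ ^ 2 * t ^ 2) := by
      have := hT₂ p (mem_of_mem_nhds hV₂) _ htV₂
      simp only [add_sub_cancel_left, map_smul, hv, smul_zero, h0, sub_zero, norm_smul,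
        Real.norm_eq_abs, mul_pow, sq_abs] at this
      linarith
    have hs' : |s| ≤ D * t ^ 2 := by
      calc |s| ≤ C₁ * (C₂ * (‖v‖ ^ 2 * t ^ 2)) := hs.trans (by gcongr)
        _ = D * t ^ 2 := by rw [hD]; ring
    have hG1 : 0 ≤ G (p + t • v - s • u) := hsV.1 hs0
    have hG2 := hT₃ _ htV.2.1 _ hsV.2.1
    have hG3 := hK.norm_sub_le htV.2.2 (mem_of_mem_nhds hV₄)
    rw [hdG, sub_zero, add_sub_cancel_left, norm_smul, Real.norm_eq_abs] at hG3
    have e : p + t • v - s • u - (p + t • v) = -(s • u) := by abel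
    rw [e, norm_neg, norm_smul, Real.norm_eq_abs] at hG2
    have hG4 : |fderiv ℝ G (p + t • v) (-(s • u))| ≤ K * (|t| * ‖v‖) * (|s| * ‖u‖) := by
      have := (fderiv ℝ G (p + t • v)).le_opNorm (-(s • u))
      rw [norm_neg, norm_smul, Real.norm_eq_abs, Real.norm_eq_abs] at this
      refine this.trans ?_
      gcongr
    have h5 : K * (|t| * ‖v‖) * (|s| * ‖u‖) ≤ K * ‖v‖ * ‖u‖ * D * |t| ^ 3 := by
      calc K * (|t| * ‖v‖) * (|s| * ‖u‖) ≤ K * (|t| * ‖v‖) * (D * t ^ 2 * ‖u‖) := by gcongr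
        _ = _ := by rw [← sq_abs t]; ring
    have h6 : C₃ * (|s| * ‖u‖) ^ 2 ≤ C₃ * ‖u‖ ^ 2 * D ^ 2 * |t| ^ 3 := by
      calc C₃ * (|s| * ‖u‖) ^ 2 ≤ C₃ * (D * t ^ 2 * ‖u‖) ^ 2 := by gcongr
        _ = C₃ * ‖u‖ ^ 2 * D ^ 2 * (|t| ^ 3 * |t|) := by rw [← sq_abs t]; ring
        _ ≤ C₃ * ‖u‖ ^ 2 * D ^ 2 * (|t| ^ 3 * 1) := by gcongr
        _ = _ := by ring
    have := abs_le.1 hG2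
    have := abs_le.1 hG4
    nlinarith
  exact fderiv_fderiv_nonneg_of_neg_cube_le hG hG0 hdG hlow

/-- The elementary inequality behind Glaeser's: a nonnegative function with second derivative bounded
by `2 * C` has the square of its first derivative bounded by `4 * C` times its value. -/
lemma sq_le_of_forall_nonneg {a b C t₀ : ℝ} (hC : 0 < C) (hb : |b| ≤ 2 * C * t₀)
    (h : ∀ t, |t| ≤ t₀ → 0 ≤ a + t * b + C * t ^ 2) : b ^ 2 ≤ 4 * C * a := by
  have h1 := h (-b / (2 * C)) (by
    rw [abs_div, abs_neg, abs_of_pos (by positivity : 0 < 2 * C), div_le_iff₀ (by positivity)]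
    linarith)
  have e : a + -b / (2 * C) * b + C * (-b / (2 * C)) ^ 2 = (4 * C * a - b ^ 2) / (4 * C) := by
    field_simp; ring
  rw [e, le_div_iff₀ (by positivity)] at h1
  linarith

/-- Glaeser's inequality on the zero set of `r`: where a function is nonnegative on this set, its
tangential derivatives are bounded by its square root. -/
lemma exists_sq_fderiv_le_of_nonneg_on_zeros {r F : E → ℝ} {p : E}
    (hr : ContDiffAt ℝ 2 r p) (hF : ContDiffAt ℝ 2 F p) (h0 : r p = 0) (hdr : fderiv ℝ r p ≠ 0)
    (hpos : ∀ᶠ q in 𝓝 p, r q = 0 → 0 ≤ F q) :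
    ∃ C > 0, ∀ᶠ q in 𝓝 p, r q = 0 → ∀ v, fderiv ℝ r q v = 0 →
      fderiv ℝ F q v ^ 2 ≤ C * F q * ‖v‖ ^ 2 := by
  obtain ⟨u, hu⟩ := exists_fderiv_pos hdr
  obtain ⟨C₁, hC₁, hproj⟩ := exists_zero_on_line (hr.of_le (by norm_num)) h0 hu
  obtain ⟨C₂, hC₂, V₂, hV₂, hT₂⟩ := exists_abs_sub_fderiv_le hr
  obtain ⟨C₃, hC₃, V₃, hV₃, hT₃⟩ := exists_abs_sub_fderiv_le hF
  have hdF : ContinuousAt (fun q => ‖fderiv ℝ F q‖) p :=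
    (hF.fderiv_right (m := 1) (by norm_num)).continuousAt.norm
  set B : ℝ := ‖fderiv ℝ F p‖ + 1 with hB
  have hB0 : 0 < B := by positivity
  have hV := Filter.inter_mem hpos hV₃
  obtain ⟨ε, hε, hball⟩ := Metric.mem_nhds_iff.1
    (Filter.inter_mem (Filter.inter_mem (hproj _ hV) hV₂) hV)
  set t₀ : ℝ := min 1 (ε / 2) with ht₀
  have ht₀pos : 0 < t₀ := by positivity
  set D : ℝ := C₁ * C₂ with hD
  have hD0 : 0 < D := by positivity
  set C : ℝ := B * D * ‖u‖ + C₃ * (1 + D * ‖u‖) ^ 2 + B / (2 * t₀) with hC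
  have hCpos : 0 < C := by positivity
  refine ⟨4 * C, by positivity, ?_⟩
  filter_upwards [ball_mem_nhds p (half_pos hε),
    hdF.eventually (gt_mem_nhds (show ‖fderiv ℝ F p‖ < B by rw [hB]; linarith))]
    with q hq hqB hq0 v hv
  -- By homogeneity it suffices to treat unit vectors.
  suffices H : ∀ w, ‖w‖ = 1 → fderiv ℝ r q w = 0 → fderiv ℝ F q w ^ 2 ≤ 4 * C * F q by
    rcases eq_or_ne v 0 with rfl | hv0
    · simp
    · have hn : 0 < ‖v‖ := norm_pos_iff.2 hv0
      have := H (‖v‖⁻¹ • v) (by rw [norm_smul, norm_inv, norm_norm]; field_simp)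
        (by rw [map_smul, hv, smul_zero])
      rw [map_smul, smul_eq_mul, mul_pow, inv_pow] at this
      have h2 : ((‖v‖ ^ 2)⁻¹ * fderiv ℝ F q v ^ 2) * ‖v‖ ^ 2 ≤ 4 * C * F q * ‖v‖ ^ 2 := by gcongr
      have h3 : ((‖v‖ ^ 2)⁻¹ * fderiv ℝ F q v ^ 2) * ‖v‖ ^ 2 = fderiv ℝ F q v ^ 2 := by field_simp
      linarith
  intro w hw hrw
  have hqε : q ∈ ball p ε := ball_subset_ball (by linarith) hq
  refine sq_le_of_forall_nonneg (t₀ := t₀) hCpos ?_ fun t ht => ?_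
  · have h1 := (fderiv ℝ F q).le_opNorm w
    rw [hw, mul_one, Real.norm_eq_abs] at h1
    have h2 : 2 * (B / (2 * t₀)) * t₀ = B := by field_simp
    have h3 : 2 * (B / (2 * t₀)) * t₀ ≤ 2 * C * t₀ := by
      gcongr
      rw [hC]
      have : 0 ≤ B * D * ‖u‖ + C₃ * (1 + D * ‖u‖) ^ 2 := by positivity
      linarith
    linarith
  · have htε : |t| ≤ ε / 2 := ht.trans (min_le_right _ _)
    have ht1 : |t| ≤ 1 := ht.trans (min_le_left _ _)
    have hqt : q + t • w ∈ ball p ε := by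
      rw [mem_ball_iff_norm] at hq ⊢
      calc ‖q + t • w - p‖ = ‖(q - p) + t • w‖ := by congr 1; abel
        _ ≤ ‖q - p‖ + ‖t • w‖ := norm_add_le _ _
        _ < ε := by rw [norm_smul, hw, Real.norm_eq_abs]; linarith
    obtain ⟨s, hs, hs0, hsV⟩ := (hball hqt).1.1
    have hrt : |r (q + t • w)| ≤ C₂ * t ^ 2 := by
      have := hT₂ q (hball hqε).1.2 _ (hball hqt).1.2
      simpa only [add_sub_cancel_left, map_smul, hrw, smul_zero, hq0, sub_zero, norm_smul,
        Real.norm_eq_abs, mul_pow, sq_abs, hw, one_pow, mul_one] using this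
    have hs' : |s| ≤ D * t ^ 2 := by
      calc |s| ≤ C₁ * (C₂ * t ^ 2) := hs.trans (by gcongr)
        _ = D * t ^ 2 := by rw [hD]; ring
    have hF1 : 0 ≤ F (q + t • w - s • u) := hsV.1 hs0
    have hF2 := hT₃ _ (hball hqε).2.2 _ hsV.2
    have e : q + t • w - s • u - q = t • w - s • u := by abel
    rw [e, map_sub, map_smul, map_smul, smul_eq_mul, smul_eq_mul] at hF2
    have ht2 : t ^ 2 ≤ |t| := by rw [← sq_abs]; nlinarith [abs_nonneg t]
    have hn : ‖t • w - s • u‖ ≤ (1 + D * ‖u‖) * |t| := by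
      calc ‖t • w - s • u‖ ≤ ‖t • w‖ + ‖s • u‖ := norm_sub_le _ _
        _ = |t| + |s| * ‖u‖ := by rw [norm_smul, norm_smul, hw, Real.norm_eq_abs,
            Real.norm_eq_abs, mul_one]
        _ ≤ |t| + D * |t| * ‖u‖ := by
            have : |s| ≤ D * |t| := hs'.trans (by gcongr)
            gcongr
        _ = _ := by ring
    have hn2 : C₃ * ‖t • w - s • u‖ ^ 2 ≤ C₃ * (1 + D * ‖u‖) ^ 2 * t ^ 2 := by
      calc C₃ * ‖t • w - s • u‖ ^ 2 ≤ C₃ * ((1 + D * ‖u‖) * |t|) ^ 2 := by gcongr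
        _ = _ := by rw [mul_pow, sq_abs]; ring
    have h4 : |s * fderiv ℝ F q u| ≤ B * D * ‖u‖ * t ^ 2 := by
      have h5 := (fderiv ℝ F q).le_opNorm u
      rw [Real.norm_eq_abs] at h5
      rw [abs_mul]
      calc |s| * |fderiv ℝ F q u| ≤ (D * t ^ 2) * (B * ‖u‖) := by
            gcongr
            exact h5.trans (by gcongr)
        _ = _ := by ring
    have h6 : 0 ≤ B / (2 * t₀) * t ^ 2 := by positivity
    have := abs_le.1 hF2
    have := abs_le.1 h4
    rw [hC]
    nlinarith

end RealAnalysis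

/-! ### The complex Hessian as a real bilinear form -/

section RealLevi

lemma I_smul_I_smul {E : Type*} [AddCommGroup E] [Module ℂ E] (X : E) : Complex.I • Complex.I • X = -X := by
  rw [smul_smul, Complex.I_mul_I, neg_one_smul]

variable {E : Type*} [NormedAddCommGroup E] [NormedSpace ℝ E]

lemma fderiv_fderiv_mul {f g : E → ℝ} {q : E} (hf : ContDiffAt ℝ 2 f q) (hg : ContDiffAt ℝ 2 g q)
    (X Y : E) :
    fderiv ℝ (fderiv ℝ fun x => f x * g x) q X Y =
      f q * fderiv ℝ (fderiv ℝ g) q X Y + g q * fderiv ℝ (fderiv ℝ f) q X Y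
        + fderiv ℝ f q X * fderiv ℝ g q Y + fderiv ℝ f q Y * fderiv ℝ g q X := by
  have h1 : (fderiv ℝ fun x => f x * g x) =ᶠ[𝓝 q]
      fun x => f x • fderiv ℝ g x + g x • fderiv ℝ f x := by
    filter_upwards [hf.eventually (by simp), hg.eventually (by simp)] with x hx hx'
    exact fderiv_fun_mul (hx.differentiableAt (by simp)) (hx'.differentiableAt (by simp))
  have hf1 := (hf.differentiableAt (by simp)).hasFDerivAt
  have hg1 := (hg.differentiableAt (by simp)).hasFDerivAt
  have hf2 := ((hf.fderiv_right (m := 1) (by norm_num)).differentiableAt (by simp)).hasFDerivAt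
  have hg2 := ((hg.fderiv_right (m := 1) (by norm_num)).differentiableAt (by simp)).hasFDerivAt
  have h3 : HasFDerivAt (fun x => f x • fderiv ℝ g x + g x • fderiv ℝ f x) _ q :=
    (hf1.smul hg2).add (hg1.smul hf2)
  rw [h1.fderiv_eq, h3.fderiv]
  simp
  ring

lemma fderiv_fderiv_add {f g : E → ℝ} {q : E} (hf : ContDiffAt ℝ 2 f q) (hg : ContDiffAt ℝ 2 g q) :
    fderiv ℝ (fderiv ℝ fun x => f x + g x) q =
      fderiv ℝ (fderiv ℝ f) q + fderiv ℝ (fderiv ℝ g) q := by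
  have h1 : (fderiv ℝ fun x => f x + g x) =ᶠ[𝓝 q] fun x => fderiv ℝ f x + fderiv ℝ g x := by
    filter_upwards [hf.eventually (by simp), hg.eventually (by simp)] with x hx hx'
    exact fderiv_fun_add (hx.differentiableAt (by simp)) (hx'.differentiableAt (by simp))
  rw [h1.fderiv_eq]
  exact fderiv_fun_add ((hf.fderiv_right (m := 1) (by norm_num)).differentiableAt (by simp))
    ((hg.fderiv_right (m := 1) (by norm_num)).differentiableAt (by simp))

lemma ContDiffOn.fderiv_apply_field {f : E → ℝ} {X : E → E} {W : Set E} (hW : IsOpen W)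
    (hf : ContDiffOn ℝ ∞ f W) (hX : ContDiffOn ℝ ∞ X W) :
    ContDiffOn ℝ ∞ (fun q => fderiv ℝ f q (X q)) W :=
  (hf.fderiv_of_isOpen hW (m := ∞) (by simp)).clm_apply hX

variable [NormedSpace ℂ E]

/-- The real bilinear form `D²f(X, Y) + D²f(iX, iY)` of a real function `f` at `q`. On the diagonal
it is four times the complex Hessian form of `f`. -/
noncomputable def realLevi (f : E → ℝ) (q X Y : E) : ℝ :=
  fderiv ℝ (fderiv ℝ f) q X Y + fderiv ℝ (fderiv ℝ f) q (Complex.I • X) (Complex.I • Y)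

lemma realLevi_symm {f : E → ℝ} {q : E} (hf : ContDiffAt ℝ 2 f q) (X Y : E) :
    realLevi f q X Y = realLevi f q Y X := by
  have h := hf.isSymmSndFDerivAt (by simp)
  rw [realLevi, realLevi, h.eq X Y, h.eq (Complex.I • X)]

lemma realLevi_I_smul (f : E → ℝ) (q X Y : E) :
    realLevi f q (Complex.I • X) (Complex.I • Y) = realLevi f q X Y := by
  rw [realLevi, realLevi, I_smul_I_smul, I_smul_I_smul]
  simp only [map_neg, neg_apply, neg_neg]
  ring

lemma realLevi_I_smul_right (f : E → ℝ) (q X Y : E) :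
    realLevi f q X (Complex.I • Y) = -realLevi f q (Complex.I • X) Y := by
  rw [realLevi, realLevi, I_smul_I_smul, I_smul_I_smul]
  simp only [map_neg, neg_apply]
  ring

lemma realLevi_self_I_smul {f : E → ℝ} {q : E} (hf : ContDiffAt ℝ 2 f q) (X : E) :
    realLevi f q X (Complex.I • X) = 0 := by
  have h1 := realLevi_I_smul_right f q X X
  rw [realLevi_symm hf (Complex.I • X)] at h1
  linarith

lemma realLevi_add_left (f : E → ℝ) (q X Y Z : E) :
    realLevi f q (X + Y) Z = realLevi f q X Z + realLevi f q Y Z := by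
  simp only [realLevi, smul_add, map_add, add_apply]; ring

lemma realLevi_add_right (f : E → ℝ) (q X Y Z : E) :
    realLevi f q X (Y + Z) = realLevi f q X Y + realLevi f q X Z := by
  simp only [realLevi, smul_add, map_add]; ring

section
variable [IsScalarTower ℝ ℂ E]

lemma complex_smul_eq (a : ℂ) (X : E) : a • X = a.re • X + a.im • Complex.I • X := by
  conv_lhs => rw [← Complex.re_add_im a, add_smul, mul_smul]
  rw [← Complex.coe_algebraMap, algebraMap_smul, algebraMap_smul]

lemma I_smul_real_smul (a : ℝ) (X : E) : Complex.I • a • X = a • Complex.I • X := by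
  have h := complex_smul_eq (a : ℂ) X
  simp only [Complex.ofReal_re, Complex.ofReal_im, zero_smul, add_zero] at h
  rw [← h, smul_smul, mul_comm, mul_smul]
  have h := complex_smul_eq (a : ℂ) (Complex.I • X)
  simp only [Complex.ofReal_re, Complex.ofReal_im, zero_smul, add_zero] at h
  exact h

lemma realLevi_smul_left (f : E → ℝ) (q : E) (a : ℝ) (X Y : E) :
    realLevi f q (a • X) Y = a * realLevi f q X Y := by
  simp only [realLevi, I_smul_real_smul, map_smul, smul_apply, smul_eq_mul]
  ring

lemma realLevi_smul_right (f : E → ℝ) (q : E) (a : ℝ) (X Y : E) :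
    realLevi f q X (a • Y) = a * realLevi f q X Y := by
  simp only [realLevi, I_smul_real_smul, map_smul, smul_eq_mul]
  ring

lemma realLevi_complex_smul_self {f : E → ℝ} {q : E} (hf : ContDiffAt ℝ 2 f q) (a : ℂ) (X : E) :
    realLevi f q (a • X) (a • X) = Complex.normSq a * realLevi f q X X := by
  rw [complex_smul_eq, Complex.normSq_apply]
  simp only [realLevi_add_left, realLevi_add_right, realLevi_smul_left, realLevi_smul_right,
    realLevi_I_smul, realLevi_self_I_smul hf, realLevi_symm hf (Complex.I • X) X]
  ring

/-- Semidefiniteness of the form on the complex span of `X` and `Y` follows from a determinant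
inequality. -/
lemma realLevi_nonneg_of_sq_le {f : E → ℝ} {q : E} (hf : ContDiffAt ℝ 2 f q) {X Y : E}
    (hX : 0 ≤ realLevi f q X X) (hY : 0 ≤ realLevi f q Y Y)
    (h : realLevi f q X Y ^ 2 + realLevi f q X (Complex.I • Y) ^ 2
      ≤ realLevi f q X X * realLevi f q Y Y) (a b : ℂ) :
    0 ≤ realLevi f q (a • X + b • Y) (a • X + b • Y) := by
  -- After division by `a` it suffices to treat `a = 1`.
  rcases eq_or_ne a 0 with rfl | ha
  · rw [zero_smul, zero_add, realLevi_complex_smul_self hf]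
    exact mul_nonneg (Complex.normSq_nonneg b) hY
  have e : a • X + b • Y = a • (X + (b / a) • Y) := by
    rw [smul_add, smul_smul, mul_div_cancel₀ _ ha]
  rw [e, realLevi_complex_smul_self hf]
  refine mul_nonneg (Complex.normSq_nonneg a) ?_
  generalize b / a = c
  have e2 : realLevi f q (X + c • Y) (X + c • Y) = realLevi f q X X
      + 2 * (c.re * realLevi f q X Y + c.im * realLevi f q X (Complex.I • Y))
      + (c.re ^ 2 + c.im ^ 2) * realLevi f q Y Y := by
    rw [realLevi_add_left, realLevi_add_right, realLevi_add_right,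
      realLevi_symm hf (c • Y) X, realLevi_complex_smul_self hf, Complex.normSq_apply,
      complex_smul_eq c Y, realLevi_add_right, realLevi_smul_right, realLevi_smul_right]
    ring
  rw [e2]
  generalize realLevi f q X X = A at *
  generalize realLevi f q X Y = B at *
  generalize realLevi f q X (Complex.I • Y) = B' at *
  generalize realLevi f q Y Y = D at *
  rcases hX.lt_or_eq with hA | rfl
  · refine (mul_nonneg_iff_of_pos_left hA).1 ?_
    nlinarith [sq_nonneg (A + (c.re * B + c.im * B')), sq_nonneg (c.re * B' - c.im * B),
      mul_nonneg (add_nonneg (sq_nonneg c.re) (sq_nonneg c.im)) (sub_nonneg.2 h)]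
  · have hB : B = 0 := by nlinarith [sq_nonneg B, sq_nonneg B']
    have hB' : B' = 0 := by nlinarith [sq_nonneg B, sq_nonneg B']
    rw [hB, hB']
    nlinarith [mul_nonneg (add_nonneg (sq_nonneg c.re) (sq_nonneg c.im)) hY]

lemma realLevi_sq_le {f : E → ℝ} {q : E} (hf : ContDiffAt ℝ 2 f q)
    (hpsh : ∀ ξ, 0 ≤ realLevi f q ξ ξ) (X Y : E) :
    realLevi f q X Y ^ 2 ≤ realLevi f q X X * realLevi f q Y Y := by
  have h := discrim_le_zero (a := realLevi f q Y Y) (b := 2 * realLevi f q X Y)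
    (c := realLevi f q X X) fun t => by
      have := hpsh (X + t • Y)
      rw [realLevi_add_left, realLevi_add_right, realLevi_add_right, realLevi_symm hf (t • Y) X,
        realLevi_smul_left, realLevi_smul_right, realLevi_smul_right] at this
      linarith
  rw [discrim] at h
  linarith

end

lemma realLevi_add {f g : E → ℝ} {q : E} (hf : ContDiffAt ℝ 2 f q) (hg : ContDiffAt ℝ 2 g q)
    (X Y : E) :
    realLevi (fun x => f x + g x) q X Y = realLevi f q X Y + realLevi g q X Y := by
  simp only [realLevi, fderiv_fderiv_add hf hg, add_apply]
  ring

lemma realLevi_mul {f g : E → ℝ} {q : E} (hf : ContDiffAt ℝ 2 f q) (hg : ContDiffAt ℝ 2 g q)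
    (X Y : E) :
    realLevi (fun x => f x * g x) q X Y = f q * realLevi g q X Y + g q * realLevi f q X Y
      + (fderiv ℝ f q X * fderiv ℝ g q Y
        + fderiv ℝ f q (Complex.I • X) * fderiv ℝ g q (Complex.I • Y))
      + (fderiv ℝ f q Y * fderiv ℝ g q X
        + fderiv ℝ f q (Complex.I • Y) * fderiv ℝ g q (Complex.I • X)) := by
  simp only [realLevi, fderiv_fderiv_mul hf hg]
  ring

lemma ContDiffOn.I_smul {X : E → E} [IsScalarTower ℝ ℂ E] {W : Set E} (hX : ContDiffOn ℝ ∞ X W) :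
    ContDiffOn ℝ ∞ (fun q => Complex.I • X q) W :=
  contDiffOn_const.smul hX

lemma ContDiffOn.realLevi_apply {f : E → ℝ} [IsScalarTower ℝ ℂ E] {X Y : E → E} {W : Set E}
    (hW : IsOpen W) (hf : ContDiffOn ℝ ∞ f W) (hX : ContDiffOn ℝ ∞ X W)
    (hY : ContDiffOn ℝ ∞ Y W) : ContDiffOn ℝ ∞ (fun q => realLevi f q (X q) (Y q)) W := by
  have h2 : ContDiffOn ℝ ∞ (fderiv ℝ (fderiv ℝ f)) W :=
    (hf.fderiv_of_isOpen hW (m := ∞) (by simp)).fderiv_of_isOpen hW (by simp)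
  exact ((h2.clm_apply hX).clm_apply hY).add ((h2.clm_apply hX.I_smul).clm_apply hY.I_smul)

end RealLevi

/-! ### Wirtinger derivatives in real terms -/

section Hessian

lemma fderiv_ofReal {r : CSpace 2 → ℝ} {q : CSpace 2} (hr : DifferentiableAt ℝ r q)
    (v : CSpace 2) : fderiv ℝ (fun y => (r y : ℂ)) q v = (fderiv ℝ r q v : ℂ) := by
  have := Complex.ofRealCLM.hasFDerivAt.comp q hr.hasFDerivAt
  rw [show (fun y => (r y : ℂ)) = Complex.ofRealCLM ∘ r from rfl, this.fderiv]
  simp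

lemma complexHessian_self {r : CSpace 2 → ℝ} {q : CSpace 2} (hr : ContDiffAt ℝ 2 r q)
    (ξ : CSpace 2) : complexHessian r q ξ ξ = ((realLevi r q ξ ξ / 4 : ℝ) : ℂ) := by
  have hd1 : ∀ᶠ x in 𝓝 q, ∀ v, fderiv ℝ (fun y => (r y : ℂ)) x v = (fderiv ℝ r x v : ℂ) := by
    filter_upwards [hr.eventually (by simp)] with x hx v
    exact fderiv_ofReal (hx.differentiableAt (by simp)) v
  have h2 := ((hr.fderiv_right (m := 1) (by norm_num)).differentiableAt (by simp)).hasFDerivAt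
  have hd2 : ∀ v, HasFDerivAt (fun x => (fderiv ℝ r x v : ℂ))
      (Complex.ofRealCLM ∘L (ContinuousLinearMap.apply ℝ ℝ v ∘L fderiv ℝ (fderiv ℝ r) q)) q :=
    fun v => Complex.ofRealCLM.hasFDerivAt.comp q
      ((ContinuousLinearMap.apply ℝ ℝ v).hasFDerivAt.comp q h2)
  have hdzbar : ∀ k, HasFDerivAt (dzbar k fun y => (r y : ℂ)) _ q := fun k => by
    have := (((hd2 (EuclideanSpace.single k 1)).add
      ((hd2 (EuclideanSpace.single k Complex.I)).const_mul Complex.I)).const_mul (1 / 2 : ℂ))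
    refine this.congr_of_eventuallyEq (hd1.mono fun x hx => ?_)
    simp [dzbar, hx]
  have hI : ∀ k, (EuclideanSpace.single k Complex.I : CSpace 2)
      = Complex.I • EuclideanSpace.single k 1 := fun k => by
    ext i; simp
  have hdd : ∀ j k, dz j (dzbar k fun y => (r y : ℂ)) q = (1 / 4 : ℂ) *
      (realLevi r q (EuclideanSpace.single j 1) (EuclideanSpace.single k 1)
      + Complex.I * realLevi r q (EuclideanSpace.single j 1)
        (Complex.I • EuclideanSpace.single k 1)) := fun j k => by
    rw [dz, (hdzbar k).fderiv]
    simp only [realLevi, hI, I_smul_I_smul]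
    simp
    ring_nf
    simp only [Complex.I_sq]
    ring
  have hξ : ξ = ξ 0 • EuclideanSpace.single 0 (1 : ℂ) + ξ 1 • EuclideanSpace.single 1 (1 : ℂ) := by
    ext i; fin_cases i <;> simp
  simp only [complexHessian, Fin.sum_univ_two, hdd]
  conv_rhs => rw [hξ]
  set X : CSpace 2 := EuclideanSpace.single 0 1
  set Y : CSpace 2 := EuclideanSpace.single 1 1
  have h1 : realLevi r q Y X = realLevi r q X Y := realLevi_symm hr _ _
  have h2 : ∀ Z, realLevi r q (Complex.I • Z) Z = 0 := fun Z => by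
    rw [realLevi_symm hr, realLevi_self_I_smul hr]
  have h3 : realLevi r q (Complex.I • X) Y = -realLevi r q X (Complex.I • Y) := by
    rw [realLevi_I_smul_right, neg_neg]
  have h4 : realLevi r q Y (Complex.I • X) = -realLevi r q X (Complex.I • Y) := by
    rw [realLevi_symm hr, h3]
  have h5 : realLevi r q (Complex.I • Y) X = realLevi r q X (Complex.I • Y) :=
    realLevi_symm hr _ _
  rw [complex_smul_eq (ξ 0) X, complex_smul_eq (ξ 1) Y]
  simp only [realLevi_add_left, realLevi_add_right, realLevi_smul_left, realLevi_smul_right,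
    realLevi_I_smul, realLevi_self_I_smul hr, h1, h2, h3, h4, h5]
  generalize realLevi r q X X = A
  generalize realLevi r q Y Y = B
  generalize realLevi r q X Y = c
  generalize realLevi r q X (Complex.I • Y) = d
  obtain ⟨a, b⟩ := ξ 0
  obtain ⟨a', b'⟩ := ξ 1
  apply Complex.ext <;> simp <;> ring

lemma isPshAtPoint_iff {r : CSpace 2 → ℝ} {q : CSpace 2} (hr : ContDiffAt ℝ 2 r q) :
    IsPshAtPoint r q ↔ ∀ ξ, 0 ≤ realLevi r q ξ ξ := by
  simp only [IsPshAtPoint, complexHessian_self hr, Complex.ofReal_re]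
  exact forall_congr' fun ξ => by constructor <;> intro h <;> linarith

lemma fderiv_field_eq (f : CSpace 2 → ℂ) (q X : CSpace 2) :
    fderiv ℝ f q X = ∑ j : Fin 2, ((X j).re * fderiv ℝ f q (EuclideanSpace.single j 1)
      + (X j).im * fderiv ℝ f q (EuclideanSpace.single j Complex.I)) := by
  have hI : ∀ k, (EuclideanSpace.single k Complex.I : CSpace 2)
      = Complex.I • EuclideanSpace.single k 1 := fun k => by
    ext i; simp
  have hX : X = X 0 • EuclideanSpace.single 0 (1 : ℂ) + X 1 • EuclideanSpace.single 1 (1 : ℂ) := by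
    ext i; fin_cases i <;> simp
  conv_lhs => rw [hX, complex_smul_eq (X 0), complex_smul_eq (X 1)]
  simp [Fin.sum_univ_two, hI]

/-- The derivative along a `(1, 0)` field, in terms of the real derivative. -/
lemma applyField_eq (L : CSpace 2 → CSpace 2) (f : CSpace 2 → ℂ) (q : CSpace 2) :
    applyField L f q = (1 / 2 : ℂ) * (fderiv ℝ f q (L q)
      - Complex.I * fderiv ℝ f q (Complex.I • L q)) := by
  rw [fderiv_field_eq f q (L q), fderiv_field_eq f q (Complex.I • L q)]
  simp only [applyField, dz, Fin.sum_univ_two, PiLp.smul_apply, smul_eq_mul]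
  generalize L q 0 = a
  generalize L q 1 = b
  obtain ⟨a, a'⟩ := a
  obtain ⟨b, b'⟩ := b
  generalize fderiv ℝ f q (EuclideanSpace.single 0 1) = x
  generalize fderiv ℝ f q (EuclideanSpace.single 0 Complex.I) = y
  generalize fderiv ℝ f q (EuclideanSpace.single 1 1) = z
  generalize fderiv ℝ f q (EuclideanSpace.single 1 Complex.I) = w
  apply Complex.ext <;> simp <;> ring

lemma applyConjField_eq (L : CSpace 2 → CSpace 2) (f : CSpace 2 → ℂ) (q : CSpace 2) :
    applyConjField L f q = (1 / 2 : ℂ) * (fderiv ℝ f q (L q)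
      + Complex.I * fderiv ℝ f q (Complex.I • L q)) := by
  rw [fderiv_field_eq f q (L q), fderiv_field_eq f q (Complex.I • L q)]
  simp only [applyConjField, dzbar, Fin.sum_univ_two, PiLp.smul_apply, smul_eq_mul]
  generalize L q 0 = a
  generalize L q 1 = b
  obtain ⟨a, a'⟩ := a
  obtain ⟨b, b'⟩ := b
  generalize fderiv ℝ f q (EuclideanSpace.single 0 1) = x
  generalize fderiv ℝ f q (EuclideanSpace.single 0 Complex.I) = y
  generalize fderiv ℝ f q (EuclideanSpace.single 1 1) = z
  generalize fderiv ℝ f q (EuclideanSpace.single 1 Complex.I) = w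
  apply Complex.ext <;> simp <;> ring

lemma delPairing_eq {r : CSpace 2 → ℝ} {q : CSpace 2} (hr : DifferentiableAt ℝ r q)
    (ξ : CSpace 2) : delPairing r q ξ = (1 / 2 : ℂ) * (fderiv ℝ r q ξ
      - Complex.I * fderiv ℝ r q (Complex.I • ξ)) := by
  rw [← fderiv_ofReal hr, ← fderiv_ofReal hr, ← applyField_eq (fun _ => ξ)]
  simp [delPairing, applyField, mul_comm]

end Hessian

/-! ### Multipliers of a defining function -/

section Core
variable {E : Type*} [NormedAddCommGroup E] [NormedSpace ℝ E]

lemma ContDiffOn.contDiffAt_two {F : Type*} [NormedAddCommGroup F] [NormedSpace ℝ F] {f : E → F}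
    {W : Set E} {q : E} (hf : ContDiffOn ℝ ∞ f W) (hW : IsOpen W) (hq : q ∈ W) :
    ContDiffAt ℝ 2 f q :=
  (hf.contDiffAt (hW.mem_nhds hq)).of_le ENat.LEInfty.out

/-- A projection `q ↦ q - s q • u` along `u` to the zero set of `r`, with displacement `O(r)`. It is
not required to be continuous away from `p`. -/
lemma exists_projection {r : E → ℝ} {p u : E} (hr : ContDiffAt ℝ 1 r p) (h0 : r p = 0)
    (hu : 0 < fderiv ℝ r p u) :
    ∃ s : E → ℝ, s =O[𝓝 p] r ∧ Tendsto (fun q => q - s q • u) (𝓝 p) (𝓝[{q | r q = 0}] p) := by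
  classical
  obtain ⟨C, hC, h⟩ := exists_zero_on_line hr h0 hu
  have hex : ∀ᶠ q in 𝓝 p, ∃ s : ℝ, |s| ≤ C * |r q| ∧ r (q - s • u) = 0 :=
    (h Set.univ univ_mem).mono fun q ⟨s, hs, hs0, _⟩ => ⟨s, hs, hs0⟩
  let s : E → ℝ := fun q =>
    if hq : ∃ s : ℝ, |s| ≤ C * |r q| ∧ r (q - s • u) = 0 then hq.choose else 0
  have hs : ∀ᶠ q in 𝓝 p, |s q| ≤ C * |r q| ∧ r (q - s q • u) = 0 := by
    filter_upwards [hex] with q hq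
    simp only [s, dif_pos hq]
    exact hq.choose_spec
  have hO : s =O[𝓝 p] r := IsBigO.of_bound C (hs.mono fun q hq => by
    simpa only [Real.norm_eq_abs] using hq.1)
  refine ⟨s, hO, tendsto_nhdsWithin_iff.2 ⟨?_, hs.mono fun q hq => hq.2⟩⟩
  have hr0 : Tendsto r (𝓝 p) (𝓝 0) := by simpa [h0] using hr.continuousAt.tendsto
  have hs0 := hO.trans_tendsto hr0
  simpa using (tendsto_id (x := 𝓝 p)).sub (hs0.smul_const u)

/-- An estimate on the zero set of `r` propagates to a neighborhood with an error `O(r)`. -/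
lemma isBigO_of_isBigO_on_zeros {r f g s : E → ℝ} {p u : E} (hf : ContDiffAt ℝ 1 f p)
    (hs : s =O[𝓝 p] r) (hπ : Tendsto (fun q => q - s q • u) (𝓝 p) (𝓝[{q | r q = 0}] p))
    (hfg : f =O[𝓝[{q | r q = 0}] p] g) :
    f =O[𝓝 p] fun q => |g (q - s q • u)| + |r q| := by
  obtain ⟨C, hC, V, hV, hL⟩ := exists_abs_sub_le hf
  have h1 : (fun q => f q - f (q - s q • u)) =O[𝓝 p] r := by
    have : (fun q => f q - f (q - s q • u)) =O[𝓝 p] s := by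
      refine IsBigO.of_bound (C * ‖u‖) ?_
      filter_upwards [hV, (hπ.mono_right nhdsWithin_le_nhds).eventually hV] with q hq hq'
      have := hL _ hq' _ hq
      rw [sub_sub_cancel, norm_smul] at this
      rw [Real.norm_eq_abs]
      linarith
    exact this.trans hs
  have h2 : (fun q => f (q - s q • u)) =O[𝓝 p] fun q => g (q - s q • u) := hfg.comp_tendsto hπ
  have h3 : f = fun q => f (q - s q • u) + (f q - f (q - s q • u)) := by ext; ring
  rw [h3]
  refine (h2.trans (IsBigO.of_bound 1 (Eventually.of_forall fun q => ?_))).add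
    (h1.trans (IsBigO.of_bound 1 (Eventually.of_forall fun q => ?_)))
  · rw [one_mul, Real.norm_eq_abs, Real.norm_of_nonneg (by positivity)]
    linarith [abs_nonneg (r q)]
  · rw [one_mul, Real.norm_eq_abs, Real.norm_of_nonneg (by positivity)]
    linarith [abs_nonneg (g (q - s q • u))]

variable [NormedSpace ℂ E]

/-- A smooth field `L` on the neighborhood `W` of the zero `p` of `r` which is complex tangential to
all level sets of `r`, together with a vector `u` along which `r` increases at `p`. -/
structure IsTangentFrame (r : E → ℝ) (L : E → E) (u p : E) (W : Set E) : Prop where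
  isOpen : IsOpen W
  mem : p ∈ W
  smooth : ContDiffOn ℝ ∞ r W
  smooth_field : ContDiffOn ℝ ∞ L W
  eq_zero : r p = 0
  pos : 0 < fderiv ℝ r p u
  tangent : ∀ q ∈ W, fderiv ℝ r q (L q) = 0
  tangent_I : ∀ q ∈ W, fderiv ℝ r q (Complex.I • L q) = 0

/-- The form `realLevi r` on the field `L`. If `L` is complex tangential to the level sets of `r`, this
is four times their Levi form. -/
noncomputable def leviForm (r : E → ℝ) (L : E → E) (q : E) : ℝ := realLevi r q (L q) (L q)

namespace IsTangentFrame

variable {r : E → ℝ} {L : E → E} {u p : E} {W : Set E}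

lemma mono (h : IsTangentFrame r L u p W) {W' : Set E} (hW' : IsOpen W') (hp : p ∈ W')
    (hsub : W' ⊆ W) : IsTangentFrame r L u p W' :=
  ⟨hW', hp, h.smooth.mono hsub, h.smooth_field.mono hsub, h.eq_zero, h.pos,
    fun q hq => h.tangent q (hsub hq), fun q hq => h.tangent_I q (hsub hq)⟩

lemma mem_nhds (h : IsTangentFrame r L u p W) : W ∈ 𝓝 p := h.isOpen.mem_nhds h.mem

lemma fderiv_ne_zero (h : IsTangentFrame r L u p W) : fderiv ℝ r p ≠ 0 := fun h' => by
  have := h.pos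
  simp [h'] at this

lemma isBigO_one (h : IsTangentFrame r L u p W) {f : E → ℝ} (hf : ContDiffOn ℝ ∞ f W) :
    f =O[𝓝[{q | r q = 0}] p] fun _ => (1 : ℝ) :=
  ((hf.contDiffAt_two h.isOpen h.mem).continuousAt.tendsto.isBigO_one ℝ).mono nhdsWithin_le_nhds

variable [IsScalarTower ℝ ℂ E]

lemma smooth_leviForm (h : IsTangentFrame r L u p W) {f : E → ℝ} (hf : ContDiffOn ℝ ∞ f W) :
    ContDiffOn ℝ ∞ (leviForm f L) W :=
  hf.realLevi_apply h.isOpen h.smooth_field h.smooth_field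

lemma isBigO_sqrt_leviForm (h : IsTangentFrame r L u p W)
    (hlevi : ∀ᶠ q in 𝓝[{q | r q = 0}] p, 0 ≤ leviForm r L q) :
    leviForm r L =O[𝓝[{q | r q = 0}] p] fun q => √(leviForm r L q) := by
  have h1 : (fun q => √(leviForm r L q)) =O[𝓝[{q | r q = 0}] p] fun _ => (1 : ℝ) := by
    have : ContinuousAt (fun q => √(leviForm r L q)) p :=
      ((h.smooth_leviForm h.smooth).contDiffAt_two h.isOpen h.mem).continuousAt.sqrt
    exact (this.tendsto.isBigO_one ℝ).mono nhdsWithin_le_nhds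
  have h2 := h1.mul (isBigO_refl (fun q => √(leviForm r L q)) _)
  simp only [one_mul] at h2
  refine h2.congr' (hlevi.mono fun q hq => ?_) EventuallyEq.rfl
  exact Real.mul_self_sqrt hq

/-- The multiplier `H`, equal to one plus a multiple of `F`, cancels the normal derivative of the
Levi form up to the square root of the Levi form. -/
lemma exists_multiplier (h : IsTangentFrame r L u p W) {F : E → ℝ} (hF : ContDiffOn ℝ ∞ F W)
    (hlevi : ∀ᶠ q in 𝓝[{q | r q = 0}] p, 0 ≤ leviForm r L q)
    (hF0 : ∀ᶠ q in 𝓝[{q | r q = 0}] p, 0 ≤ F q) (hFp : F p = 0)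
    (hFO : F =O[𝓝[{q | r q = 0}] p] leviForm r L) (hκ : leviForm F L p ≠ 0) :
    ∃ W' ⊆ W, IsOpen W' ∧ p ∈ W' ∧ ∃ H : E → ℝ, ContDiffOn ℝ ∞ H W' ∧ H p = 1 ∧
      (fun q => H q - 1) =O[𝓝[{q | r q = 0}] p] (fun q => √(leviForm r L q)) ∧
      (fun q => fderiv ℝ H q (L q)) =O[𝓝[{q | r q = 0}] p] (fun q => √(leviForm r L q)) ∧
      (fun q => fderiv ℝ H q (Complex.I • L q)) =O[𝓝[{q | r q = 0}] p]
        (fun q => √(leviForm r L q)) ∧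
      (fun q => fderiv ℝ (leviForm r L) q u + fderiv ℝ r q u * leviForm H L q)
        =O[𝓝[{q | r q = 0}] p] (fun q => √(leviForm r L q)) := by
  set l := 𝓝[{q | r q = 0}] p with hl
  have hdru : ContDiffOn ℝ ∞ (fun q => fderiv ℝ r q u) W :=
    h.smooth.fderiv_apply_field h.isOpen contDiffOn_const
  have hev : ∀ᶠ q in 𝓝 p, q ∈ W ∧ leviForm F L q ≠ 0 ∧ fderiv ℝ r q u ≠ 0 :=
    Eventually.and h.mem_nhds
      (((((h.smooth_leviForm hF).contDiffAt_two h.isOpen h.mem).continuousAt).eventually_ne hκ).and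
      (((hdru.contDiffAt_two h.isOpen h.mem).continuousAt).eventually_ne h.pos.ne'))
  obtain ⟨W', hW', hW'o, hpW'⟩ := _root_.eventually_nhds_iff.1 hev
  have h' := h.mono hW'o hpW' fun q hq => (hW' q hq).1
  have hFW := hF.mono fun q hq => (hW' q hq).1
  have hlam := h'.smooth_leviForm h'.smooth
  set μ : E → ℝ := fun q => -fderiv ℝ (leviForm r L) q u / (fderiv ℝ r q u * leviForm F L q)
    with hμdef
  have hμ : ContDiffOn ℝ ∞ μ W' :=
    (hlam.fderiv_apply_field hW'o contDiffOn_const).neg.div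
      ((hdru.mono fun q hq => (hW' q hq).1).mul (h'.smooth_leviForm hFW))
      fun q hq => mul_ne_zero (hW' q hq).2.2 (hW' q hq).2.1
  have hW'l : ∀ᶠ q in l, q ∈ W' := nhdsWithin_le_nhds h'.mem_nhds
  have hsq := h'.isBigO_sqrt_leviForm hlevi
  have hFs := hFO.trans hsq
  obtain ⟨C, hC, hG⟩ := exists_sq_fderiv_le_of_nonneg_on_zeros
    (h'.smooth.contDiffAt_two hW'o hpW') (hFW.contDiffAt_two hW'o hpW') h.eq_zero
    h.fderiv_ne_zero (eventually_nhdsWithin_iff.1 hF0)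
  have hG' : ∀ᶠ q in l, ∀ v, fderiv ℝ r q v = 0 → fderiv ℝ F q v ^ 2 ≤ C * F q * ‖v‖ ^ 2 :=
    eventually_nhdsWithin_iff.2 hG
  have hdF : ∀ X : E → E, ContDiffOn ℝ ∞ X W' → (∀ q ∈ W', fderiv ℝ r q (X q) = 0) →
      (fun q => fderiv ℝ F q (X q)) =O[l] fun q => √(leviForm r L q) := by
    intro X hX hrX
    have h1 : (fun q => fderiv ℝ F q (X q) ^ 2) =O[l] leviForm r L := by
      have h2 : (fun q => C * F q * ‖X q‖ ^ 2) =O[l] leviForm r L := by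
        have hXc : (fun q => ‖X q‖ ^ 2) =O[l] fun _ => (1 : ℝ) :=
          (((hX.contDiffAt_two hW'o hpW').continuousAt.norm.pow 2).tendsto.isBigO_one ℝ).mono
            nhdsWithin_le_nhds
        simpa using (hFO.const_mul_left C).mul hXc
      refine IsBigO.trans (IsBigO.of_bound 1 ?_) h2
      filter_upwards [hG', hW'l] with q hq hqW
      rw [one_mul, Real.norm_of_nonneg (sq_nonneg _)]
      exact (hq _ (hrX q hqW)).trans (le_abs_self _)
    obtain ⟨D, hD⟩ := h1.bound
    refine IsBigO.of_bound √D ?_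
    filter_upwards [hD, hlevi] with q hq hq0
    rw [Real.norm_of_nonneg (sq_nonneg _), Real.norm_of_nonneg hq0] at hq
    rw [Real.norm_eq_abs, Real.norm_of_nonneg (Real.sqrt_nonneg _), ← Real.sqrt_mul' _ hq0]
    exact Real.abs_le_sqrt hq
  have hdL := hdF L h'.smooth_field h'.tangent
  have hdIL := hdF (fun q => Complex.I • L q) h'.smooth_field.I_smul h'.tangent_I
  have hbd : ∀ {f g : E → ℝ}, ContDiffOn ℝ ∞ f W' → g =O[l] (fun q => √(leviForm r L q)) →
      (fun q => f q * g q) =O[l] fun q => √(leviForm r L q) := fun hf hg => by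
    simpa using (h'.isBigO_one hf).mul hg
  have hdμ : ∀ X : E → E, ContDiffOn ℝ ∞ X W' → ContDiffOn ℝ ∞ (fun q => fderiv ℝ μ q (X q)) W' :=
    fun X hX => hμ.fderiv_apply_field hW'o hX
  have hdH : ∀ q ∈ W', ∀ v, fderiv ℝ (fun x => 1 + μ x * F x) q v
      = μ q * fderiv ℝ F q v + fderiv ℝ μ q v * F q := fun q hq v => by
    rw [fderiv_const_add, fderiv_fun_mul ((hμ.contDiffAt_two hW'o hq).differentiableAt (by simp))
      ((hFW.contDiffAt_two hW'o hq).differentiableAt (by simp))]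
    simp
    ring
  have hLH : ∀ q ∈ W', leviForm (fun x => 1 + μ x * F x) L q = μ q * leviForm F L q
      + (leviForm μ L q * F q + 2 * (fderiv ℝ μ q (L q) * fderiv ℝ F q (L q))
      + 2 * (fderiv ℝ μ q (Complex.I • L q) * fderiv ℝ F q (Complex.I • L q))) := fun q hq => by
    have : realLevi (fun x => 1 + μ x * F x) q = realLevi (fun x => μ x * F x) q := by
      ext X Y
      have : (fderiv ℝ fun x => 1 + μ x * F x) = fderiv ℝ fun x => μ x * F x := by
        ext x : 1
        exact fderiv_const_add _
      simp only [realLevi, this]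
    rw [leviForm, this, realLevi_mul (hμ.contDiffAt_two hW'o hq) (hFW.contDiffAt_two hW'o hq)]
    simp only [leviForm]
    ring
  refine ⟨W', fun q hq => (hW' q hq).1, hW'o, hpW', fun q => 1 + μ q * F q,
    contDiffOn_const.add (hμ.mul hFW), by simp [hFp], ?_, ?_, ?_, ?_⟩
  · simpa using hbd hμ hFs
  · refine ((hbd hμ hdL).add (hbd (hdμ L h'.smooth_field) hFs)).congr' ?_ EventuallyEq.rfl
    filter_upwards [hW'l] with q hq
    rw [hdH q hq]
  · refine ((hbd hμ hdIL).add (hbd (hdμ _ h'.smooth_field.I_smul) hFs)).congr' ?_ EventuallyEq.rfl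
    filter_upwards [hW'l] with q hq
    rw [hdH q hq]
  · have hsum := ((hbd (h'.smooth_leviForm hμ) hFs).add
      ((hbd (hdμ L h'.smooth_field) hdL).const_mul_left 2)).add
      ((hbd (hdμ _ h'.smooth_field.I_smul) hdIL).const_mul_left 2)
    refine (hbd (hdru.mono fun q hq => (hW' q hq).1) hsum).congr' ?_ EventuallyEq.rfl
    filter_upwards [hW'l] with q hq
    rw [hLH q hq]
    have h1 := (hW' q hq).2.1
    have h2 := (hW' q hq).2.2
    have h3 : fderiv ℝ r q u * (μ q * leviForm F L q) = -fderiv ℝ (leviForm r L) q u := by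
      simp only [hμdef]; field_simp
    linear_combination (-1 : ℝ) * h3

/-- A lower bound for the complex Hessian of `r * H` in the direction of `L`, which is the right hand
side since `L` annihilates `r`. Its derivative along `u` at the zero set is `O(√λ)` by the choice of
the multiplier `H`, so that Taylor's formula, started at the projection to the zero set, leaves an
error `O(r ^ 2)` after absorption of the first order term into the Levi form `λ`. -/
lemma exists_leviForm_mul_ge (h : IsTangentFrame r L u p W) {H s : E → ℝ}
    (hH : ContDiffOn ℝ ∞ H W) (hHp : H p = 1)
    (hlevi : ∀ᶠ q in 𝓝[{q | r q = 0}] p, 0 ≤ leviForm r L q)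
    (hH1 : (fun q => H q - 1) =O[𝓝[{q | r q = 0}] p] (fun q => √(leviForm r L q)))
    (hHu : (fun q => fderiv ℝ (leviForm r L) q u + fderiv ℝ r q u * leviForm H L q)
        =O[𝓝[{q | r q = 0}] p] (fun q => √(leviForm r L q)))
    (hs : s =O[𝓝 p] r) (hπ : Tendsto (fun q => q - s q • u) (𝓝 p) (𝓝[{q | r q = 0}] p)) :
    ∃ C, ∀ᶠ q in 𝓝 p, leviForm r L (q - s q • u) / 4 - C * r q ^ 2
      ≤ r q * leviForm H L q + H q * leviForm r L q := by
  set l := 𝓝[{q | r q = 0}] p with hl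
  have hlam := h.smooth_leviForm h.smooth
  have hHL := h.smooth_leviForm hH
  set A : E → ℝ := fun q => r q * leviForm H L q + H q * leviForm r L q with hA
  have hAs : ContDiffOn ℝ ∞ A W := (h.smooth.mul hHL).add (hH.mul hlam)
  obtain ⟨C₁, hC₁, V, hV, hT⟩ := exists_abs_sub_fderiv_le (hAs.contDiffAt_two h.isOpen h.mem)
  -- The derivative of `A` along `u` on the zero set.
  have hdA : (fun q => fderiv ℝ A q u) =O[l] fun q => √(leviForm r L q) := by
    have hsq := h.isBigO_sqrt_leviForm hlevi
    have hdu : ∀ {f : E → ℝ}, ContDiffOn ℝ ∞ f W → ContDiffOn ℝ ∞ (fun q => fderiv ℝ f q u) W :=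
      fun hf => hf.fderiv_apply_field h.isOpen contDiffOn_const
    have h1 := (h.isBigO_one (hdu hlam)).mul hH1
    have h2 := (h.isBigO_one (hdu hH)).mul hsq
    simp only [one_mul] at h1 h2
    refine ((hHu.add h1).add h2).congr' ?_ EventuallyEq.rfl
    filter_upwards [nhdsWithin_le_nhds h.mem_nhds, self_mem_nhdsWithin] with q hq hq0
    have hd : ∀ {f : E → ℝ}, ContDiffOn ℝ ∞ f W → HasFDerivAt f (fderiv ℝ f q) q := fun hf =>
      ((hf.contDiffAt_two h.isOpen hq).differentiableAt (by simp)).hasFDerivAt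
    have hq0 : r q = 0 := hq0
    have h4 : HasFDerivAt A _ q := ((hd h.smooth).mul (hd hHL)).add ((hd hH).mul (hd hlam))
    rw [h4.fderiv]
    simp [hq0]
    ring
  obtain ⟨C₂, hC₂pos, hC₂⟩ := (hdA.comp_tendsto hπ).exists_pos
  obtain ⟨C₃, hC₃pos, hC₃⟩ := hs.exists_pos
  have hHhalf : ∀ᶠ q in 𝓝 p, 1 / 2 < H q :=
    (hH.contDiffAt_two h.isOpen h.mem).continuousAt.eventually
      (lt_mem_nhds (by rw [hHp]; norm_num))
  have hπ' := hπ.mono_right nhdsWithin_le_nhds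
  refine ⟨(C₂ ^ 2 + C₁ * ‖u‖ ^ 2) * C₃ ^ 2, ?_⟩
  filter_upwards [hV, hπ'.eventually hV, hC₂.bound, hC₃.bound, hπ'.eventually hHhalf,
    hπ.eventually hlevi, hπ.eventually self_mem_nhdsWithin] with q h1 h2 h3 h4 h5 h6 h7
  have h8 := hT _ h2 _ h1
  rw [sub_sub_cancel, map_smul, smul_eq_mul, norm_smul, Real.norm_eq_abs, mul_pow, sq_abs] at h8
  simp only [Function.comp_apply, Real.norm_eq_abs, abs_of_nonneg (Real.sqrt_nonneg _)] at h3 h4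
  have h7 : r (q - s q • u) = 0 := h7
  have h9 : A (q - s q • u) = H (q - s q • u) * leviForm r L (q - s q • u) := by
    simp [hA, h7]
  set Λ := leviForm r L (q - s q • u)
  have hσ := Real.sq_sqrt h6
  set σ := √Λ
  have hσ0 : 0 ≤ σ := Real.sqrt_nonneg _
  have h10 : Λ / 2 ≤ A (q - s q • u) := by rw [h9]; nlinarith
  have h11 : |s q * fderiv ℝ A (q - s q • u) u| ≤ |s q| * (C₂ * σ) := by
    rw [abs_mul]; gcongr
  have h12 : |s q| * (C₂ * σ) ≤ σ ^ 2 / 4 + C₂ ^ 2 * |s q| ^ 2 := by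
    nlinarith [sq_nonneg (σ / 2 - C₂ * |s q|)]
  have h13 : (C₂ ^ 2 + C₁ * ‖u‖ ^ 2) * |s q| ^ 2 ≤ (C₂ ^ 2 + C₁ * ‖u‖ ^ 2) * (C₃ * |r q|) ^ 2 := by
    gcongr
  rw [mul_pow, sq_abs, sq_abs] at h13
  rw [sq_abs] at h12
  change Λ / 4 - _ ≤ A q
  have := abs_le.1 h8
  have := abs_le.1 h11
  nlinarith

end IsTangentFrame

end Core

/-! ### From semidefiniteness on the zero set to a neighborhood -/

section Modification
variable {E : Type*} [NormedAddCommGroup E] [NormedSpace ℝ E] [NormedSpace ℂ E]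

/-- A function with prescribed value and vanishing gradient at `p`, and with large complex Hessian in
a given direction. -/
lemma exists_realLevi_gt {p X : E} (hX : X ≠ 0) (K M : ℝ) :
    ∃ k : E → ℝ, ContDiff ℝ ∞ k ∧ k p = K ∧ fderiv ℝ k p = 0 ∧ M < realLevi k p X X := by
  obtain ⟨ℓ, hℓ⟩ := SeparatingDual.exists_ne_zero (R := ℝ) hX
  have hs : ContDiff ℝ ∞ fun x => ℓ (x - p) := ℓ.contDiff.comp (contDiff_id.sub contDiff_const)
  set c : ℝ := (|M| + 1) / ℓ X ^ 2 with hc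
  have hX2 : 0 < ℓ X ^ 2 := by positivity
  have hd : ∀ x, HasFDerivAt (fun x => ℓ (x - p)) ℓ x := fun x =>
    ℓ.hasFDerivAt.comp x ((hasFDerivAt_id x).sub_const p)
  have hdf : (fderiv ℝ fun x => ℓ (x - p)) = fun _ => ℓ := funext fun x => (hd x).fderiv
  have hcs : ContDiff ℝ ∞ fun x => c * ℓ (x - p) := contDiff_const.mul hs
  have hdc : (fderiv ℝ fun x => c * ℓ (x - p)) = fun _ => c • ℓ :=
    funext fun x => ((hd x).const_mul c).fderiv
  refine ⟨fun x => K + c * ℓ (x - p) * ℓ (x - p), contDiff_const.add (hcs.mul hs), by simp, ?_, ?_⟩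
  · rw [fderiv_const_add, fderiv_fun_mul (hcs.differentiable (by simp) p) (hd p).differentiableAt]
    simp
  · rw [realLevi_add contDiffAt_const ((hcs.mul hs).contDiffAt.of_le ENat.LEInfty.out),
      realLevi_mul (hcs.contDiffAt.of_le ENat.LEInfty.out) (hs.contDiffAt.of_le ENat.LEInfty.out)]
    simp only [realLevi, hdf, hdc, fderiv_fun_const]
    have h1 : c * ℓ X ^ 2 = |M| + 1 := by rw [hc]; field_simp
    have h2 : 0 ≤ c := by positivity
    have h3 := mul_nonneg h2 (sq_nonneg (ℓ (Complex.I • X)))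
    simp
    nlinarith [le_abs_self M]

lemma realLevi_mul_add_mul {r H k : E → ℝ} {q X : E} (hr : ContDiffAt ℝ 2 r q)
    (hH : ContDiffAt ℝ 2 H q) (hk : ContDiffAt ℝ 2 k q) (hX : fderiv ℝ r q X = 0)
    (hIX : fderiv ℝ r q (Complex.I • X) = 0) (Y : E) :
    realLevi (fun x => r x * (H x + r x * k x)) q X Y =
      realLevi (fun x => r x * H x) q X Y + 2 * r q * k q * realLevi r q X Y
      + r q * (r q * realLevi k q X Y + 2 * (fderiv ℝ r q Y * fderiv ℝ k q X
        + fderiv ℝ r q (Complex.I • Y) * fderiv ℝ k q (Complex.I • X))) := by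
  have hd : ∀ v, fderiv ℝ (fun x => H x + r x * k x) q v
      = fderiv ℝ H q v + (r q * fderiv ℝ k q v + k q * fderiv ℝ r q v) := fun v => by
    rw [fderiv_fun_add (hH.differentiableAt (by simp)) ((hr.mul hk).differentiableAt (by simp)),
      fderiv_fun_mul (hr.differentiableAt (by simp)) (hk.differentiableAt (by simp))]
    simp
  rw [realLevi_mul hr (hH.add (hr.mul hk)), realLevi_mul hr hH, realLevi_add hH (hr.mul hk),
    realLevi_mul hr hk]
  simp only [hd, hX, hIX]
  ring

lemma sq_add_sq_le_of_bounds {C K σ r k A lam γ a ε B α B' ε' α' D A₁ : ℝ} (hC : 0 ≤ C)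
    (hK : 0 ≤ K) (hσ : 0 ≤ σ)
    (hA : A = A₁ + 2 * r * k * lam + r * (r * γ)) (hA₁ : σ ^ 2 / 4 - C * r ^ 2 ≤ A₁)
    (hlam : |lam| ≤ C * (σ ^ 2 + |r|)) (hk : |k| ≤ K + 1)
    (hr : 2 * C * (K + 1) * |r| ≤ 1 / 8) (hγ : 1 + C + 2 * C * (K + 1) ≤ γ)
    (hB : B = a + 2 * r * k * α + r * ε) (ha : |a| ≤ C * (σ + |r|)) (hα : |α| ≤ C * (σ + |r|))
    (hε : |ε| ≤ 1) {a' : ℝ}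
    (hB' : B' = a' + 2 * r * k * α' + r * ε') (ha' : |a'| ≤ C * (σ + |r|))
    (hα' : |α'| ≤ C * (σ + |r|)) (hε' : |ε'| ≤ 1) (hD : 32 * (C + 2) ^ 2 ≤ D) :
    0 ≤ A ∧ B ^ 2 + B' ^ 2 ≤ A * D := by
  have hr0 := abs_nonneg r
  have hAge : (σ ^ 2 + r ^ 2) / 8 ≤ A := by
    have h1 : |2 * r * k * lam| ≤ 2 * |r| * (K + 1) * (C * (σ ^ 2 + |r|)) := by
      rw [abs_mul, abs_mul, abs_mul, abs_two]; gcongr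
    have h2 : 2 * C * (K + 1) * |r| * σ ^ 2 ≤ 1 / 8 * σ ^ 2 := by gcongr
    have h3 : (1 + C + 2 * C * (K + 1)) * r ^ 2 ≤ γ * r ^ 2 := by gcongr
    have h4 := (abs_le.1 h1).1
    have h5 : 2 * |r| * (K + 1) * (C * (σ ^ 2 + |r|)) =
      2 * C * (K + 1) * |r| * σ ^ 2 + 2 * C * (K + 1) * r ^ 2 := by rw [← sq_abs r]; ring
    nlinarith [sq_nonneg r]
  have key : ∀ {B a α ε : ℝ}, B = a + 2 * r * k * α + r * ε → |a| ≤ C * (σ + |r|) →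
      |α| ≤ C * (σ + |r|) → |ε| ≤ 1 → B ^ 2 ≤ 2 * (C + 2) ^ 2 * (σ ^ 2 + r ^ 2) := by
    intro B a α ε hB ha hα hε
    have h1 : |2 * r * k * α| ≤ 2 * |r| * (K + 1) * (C * (σ + |r|)) := by
      rw [abs_mul, abs_mul, abs_mul, abs_two]; gcongr
    have h2 : |r * ε| ≤ |r| * 1 := by rw [abs_mul]; gcongr
    have h3 : 2 * C * (K + 1) * |r| * (σ + |r|) ≤ 1 / 8 * (σ + |r|) := by gcongr
    have h4 : |B| ≤ (C + 2) * (σ + |r|) := by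
      rw [hB]
      have := abs_add_le (a + 2 * r * k * α) (r * ε)
      have := abs_add_le a (2 * r * k * α)
      nlinarith
    calc B ^ 2 = |B| ^ 2 := (sq_abs B).symm
      _ ≤ ((C + 2) * (σ + |r|)) ^ 2 := by gcongr
      _ = (C + 2) ^ 2 * (σ + |r|) ^ 2 := by ring
      _ ≤ (C + 2) ^ 2 * (2 * (σ ^ 2 + |r| ^ 2)) := by
          gcongr
          nlinarith [sq_nonneg (σ - |r|)]
      _ = _ := by rw [sq_abs]; ring
  have h1 := key hB ha hα hε
  have h2 := key hB' ha' hα' hε'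
  have h0 : 0 ≤ (σ ^ 2 + r ^ 2) / 8 := by positivity
  refine ⟨h0.trans hAge, ?_⟩
  calc B ^ 2 + B' ^ 2 ≤ (σ ^ 2 + r ^ 2) / 8 * (32 * (C + 2) ^ 2) := by linarith
    _ ≤ A * D := by gcongr; exact h0.trans hAge

namespace IsTangentFrame

variable {r : E → ℝ} {L : E → E} {u p : E} {W : Set E} [IsScalarTower ℝ ℂ E]

lemma smooth_realLevi (h : IsTangentFrame r L u p W) {f : E → ℝ} (hf : ContDiffOn ℝ ∞ f W)
    (v : E) : ContDiffOn ℝ ∞ (fun q => realLevi f q (L q) v) W :=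
  hf.realLevi_apply h.isOpen h.smooth_field contDiffOn_const

/-- By the Cauchy-Schwarz inequality, semidefiniteness on the zero set bounds the mixed terms there
by the square root of the Levi form. -/
lemma isBigO_realLevi (h : IsTangentFrame r L u p W)
    (hpsh : ∀ᶠ q in 𝓝[{q | r q = 0}] p, ∀ ξ, 0 ≤ realLevi r q ξ ξ) (v : E) :
    (fun q => realLevi r q (L q) v) =O[𝓝[{q | r q = 0}] p] fun q => √(leviForm r L q) := by
  have hv : ContDiffOn ℝ ∞ (fun q => realLevi r q v v) W :=
    h.smooth.realLevi_apply h.isOpen contDiffOn_const contDiffOn_const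
  obtain ⟨C, hC⟩ := (h.isBigO_one hv).bound
  refine IsBigO.of_bound √C ?_
  filter_upwards [hC, hpsh, nhdsWithin_le_nhds h.mem_nhds] with q hq hq' hqW
  have h0 : 0 ≤ leviForm r L q := hq' _
  have hcs := realLevi_sq_le (h.smooth.contDiffAt_two h.isOpen hqW) hq' (L q) v
  rw [Real.norm_eq_abs, norm_one, mul_one] at hq
  rw [Real.norm_eq_abs, Real.norm_of_nonneg (Real.sqrt_nonneg _), ← Real.sqrt_mul' _ h0]
  refine Real.abs_le_sqrt (hcs.trans ?_)
  rw [mul_comm]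
  exact mul_le_mul_of_nonneg_right ((le_abs_self _).trans hq) h0

lemma isBigO_realLevi_mul (h : IsTangentFrame r L u p W) {H : E → ℝ} (hH : ContDiffOn ℝ ∞ H W)
    (hpsh : ∀ᶠ q in 𝓝[{q | r q = 0}] p, ∀ ξ, 0 ≤ realLevi r q ξ ξ)
    (hHL : (fun q => fderiv ℝ H q (L q)) =O[𝓝[{q | r q = 0}] p] (fun q => √(leviForm r L q)))
    (hHIL : (fun q => fderiv ℝ H q (Complex.I • L q)) =O[𝓝[{q | r q = 0}] p]
      (fun q => √(leviForm r L q))) (v : E) :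
    (fun q => realLevi (fun x => r x * H x) q (L q) v) =O[𝓝[{q | r q = 0}] p]
      fun q => √(leviForm r L q) := by
  have hd : ∀ v, ContDiffOn ℝ ∞ (fun q => fderiv ℝ r q v) W := fun v =>
    h.smooth.fderiv_apply_field h.isOpen contDiffOn_const
  have h1 := (h.isBigO_one hH).mul (h.isBigO_realLevi hpsh v)
  have h2 := (h.isBigO_one (hd v)).mul hHL
  have h3 := (h.isBigO_one (hd (Complex.I • v))).mul hHIL
  simp only [one_mul] at h1 h2 h3
  refine ((h1.add h2).add h3).congr' ?_ EventuallyEq.rfl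
  filter_upwards [nhdsWithin_le_nhds h.mem_nhds, self_mem_nhdsWithin] with q hq hq0
  have hq0 : r q = 0 := hq0
  rw [realLevi_mul (h.smooth.contDiffAt_two h.isOpen hq) (hH.contDiffAt_two h.isOpen hq),
    h.tangent q hq, h.tangent_I q hq, hq0]
  ring

/-- If `r` has semidefinite complex Hessian on its zero set, and `F` is a nonnegative function on the
zero set which is dominated by the Levi form and has nonvanishing complex Hessian in the direction
`L p`, then some multiple of `r` has semidefinite complex Hessian on a full neighborhood. -/
theorem exists_psh_multiple (h : IsTangentFrame r L u p W) {F : E → ℝ} (hF : ContDiffOn ℝ ∞ F W)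
    (hpsh : ∀ᶠ q in 𝓝[{q | r q = 0}] p, ∀ ξ, 0 ≤ realLevi r q ξ ξ)
    (hF0 : ∀ᶠ q in 𝓝[{q | r q = 0}] p, 0 ≤ F q) (hFp : F p = 0)
    (hFO : F =O[𝓝[{q | r q = 0}] p] leviForm r L) (hκ : leviForm F L p ≠ 0)
    (hspan : ∀ᶠ q in 𝓝 p, ∀ ξ, ∃ a b : ℂ, ξ = a • L q + b • u) :
    ∃ V ⊆ W, IsOpen V ∧ p ∈ V ∧ ∃ H : E → ℝ, ContDiffOn ℝ ∞ H V ∧ (∀ q ∈ V, 0 < H q) ∧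
      ∀ q ∈ V, ∀ ξ, 0 ≤ realLevi (fun x => r x * H x) q ξ ξ := by
  have hlevi : ∀ᶠ q in 𝓝[{q | r q = 0}] p, 0 ≤ leviForm r L q := hpsh.mono fun q hq => hq _
  obtain ⟨W', hW'W, hW'o, hpW', H, hH, hHp, hH1, hHL, hHIL, hHu⟩ :=
    h.exists_multiplier hF hlevi hF0 hFp hFO hκ
  replace h := h.mono hW'o hpW' hW'W
  obtain ⟨s, hs, hπ⟩ := exists_projection
    ((h.smooth.contDiffAt_two h.isOpen h.mem).of_le (by norm_num)) h.eq_zero h.pos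
  have hcont : ∀ {f : E → ℝ}, ContDiffOn ℝ ∞ f W' → ContinuousAt f p := fun hf =>
    (hf.contDiffAt_two h.isOpen h.mem).continuousAt
  have hprop : ∀ {f g : E → ℝ}, ContDiffOn ℝ ∞ f W' → f =O[𝓝[{q | r q = 0}] p] g →
      ∃ C ≥ 0, ∀ᶠ q in 𝓝 p, |f q| ≤ C * (|g (q - s q • u)| + |r q|) := fun hf hfg => by
    obtain ⟨C, hC, hb⟩ := (isBigO_of_isBigO_on_zeros
      ((hf.contDiffAt_two h.isOpen h.mem).of_le (by norm_num)) hs hπ hfg).exists_pos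
    refine ⟨C, hC.le, hb.bound.mono fun q hq => ?_⟩
    rwa [Real.norm_eq_abs, Real.norm_of_nonneg (by positivity)] at hq
  obtain ⟨C₀, hC₀⟩ := h.exists_leviForm_mul_ge hH hHp hlevi hH1 hHu hs hπ
  obtain ⟨C₁, hC₁0, hC₁⟩ := hprop (h.smooth_leviForm h.smooth) (isBigO_refl _ _)
  have hrH := h.smooth.mul hH
  have hmix : ∀ v, ∃ C ≥ 0, ∀ᶠ q in 𝓝 p,
      |realLevi (fun x => r x * H x) q (L q) v| ≤ C * (√(leviForm r L (q - s q • u)) + |r q|) ∧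
      |realLevi r q (L q) v| ≤ C * (√(leviForm r L (q - s q • u)) + |r q|) := fun v => by
    obtain ⟨C, hC0, hC⟩ := hprop (h.smooth_realLevi hrH v)
      (h.isBigO_realLevi_mul hH hpsh hHL hHIL v)
    obtain ⟨C', hC'0, hC'⟩ := hprop (h.smooth_realLevi h.smooth v) (h.isBigO_realLevi hpsh v)
    refine ⟨C + C', by positivity, ?_⟩
    filter_upwards [hC, hC'] with q hq hq'
    rw [abs_of_nonneg (Real.sqrt_nonneg _)] at hq hq'
    set t := √(leviForm r L (q - s q • u)) + |r q|
    have ht : 0 ≤ t := by positivity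
    exact ⟨hq.trans (by gcongr; linarith), hq'.trans (by gcongr; linarith)⟩
  obtain ⟨C₂, hC₂0, hC₂⟩ := hmix u
  obtain ⟨C₃, hC₃0, hC₃⟩ := hmix (Complex.I • u)
  set C : ℝ := |C₀| + C₁ + C₂ + C₃ with hCdef
  have hC0 : 0 ≤ C := by positivity
  clear_value C
  have hn : 0 < fderiv ℝ r p u ^ 2 + fderiv ℝ r p (Complex.I • u) ^ 2 := by
    have := h.pos; positivity
  -- The multiple `K * r ^ 2` makes the Hessian large in the direction `u`; the function `k`, equal
  -- to `K` at `p`, also gives a gain of order `r ^ 2` in the direction of `L`.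
  set K : ℝ := (32 * (C + 2) ^ 2 + 1 + |realLevi (fun x => r x * H x) p u u|) /
    (2 * (fderiv ℝ r p u ^ 2 + fderiv ℝ r p (Complex.I • u) ^ 2)) with hKdef
  have hK0 : 0 ≤ K := by positivity
  have hLp : L p ≠ 0 := fun h0 => hκ (by rw [leviForm, h0]; simp [realLevi])
  obtain ⟨k, hk, hkp, hdk, hγ⟩ := exists_realLevi_gt hLp K (1 + C + 2 * C * (K + 1)) (p := p)
  have hkW : ContDiffOn ℝ ∞ k W' := hk.contDiffOn
  set G : E → ℝ := fun x => H x + r x * k x with hG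
  have hGs : ContDiffOn ℝ ∞ G W' := hH.add (h.smooth.mul hkW)
  have hρ : ContDiffOn ℝ ∞ (fun x => r x * G x) W' := h.smooth.mul hGs
  have hDp : 32 * (C + 2) ^ 2 < realLevi (fun x => r x * G x) p u u := by
    have hr2 := h.smooth.contDiffAt_two h.isOpen h.mem
    have hH2 := hH.contDiffAt_two h.isOpen h.mem
    have hk2 := hkW.contDiffAt_two h.isOpen h.mem
    have e : realLevi (fun x => r x * G x) p u u = realLevi (fun x => r x * H x) p u u
        + K * (2 * (fderiv ℝ r p u ^ 2 + fderiv ℝ r p (Complex.I • u) ^ 2)) := by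
      have e1 : (fun x => r x * G x) = fun x => r x * H x + r x * (r x * k x) := by
        ext x; simp only [hG]; ring
      rw [e1, realLevi_add (hr2.mul hH2) (hr2.mul (hr2.mul hk2)), realLevi_mul hr2 (hr2.mul hk2),
        fderiv_fun_mul (hr2.differentiableAt (by simp)) (hk2.differentiableAt (by simp)), hdk,
        h.eq_zero, hkp]
      simp
      ring
    rw [e, hKdef, div_mul_cancel₀ _ (by positivity)]
    linarith [neg_abs_le (realLevi (fun x => r x * H x) p u u)]
  have hεs : ∀ v, ∀ᶠ q in 𝓝 p, |r q * realLevi k q (L q) v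
      + 2 * (fderiv ℝ r q v * fderiv ℝ k q (L q)
        + fderiv ℝ r q (Complex.I • v) * fderiv ℝ k q (Complex.I • L q))| < 1 := fun v => by
    have hsm : ContDiffOn ℝ ∞ (fun q => r q * realLevi k q (L q) v
        + 2 * (fderiv ℝ r q v * fderiv ℝ k q (L q)
          + fderiv ℝ r q (Complex.I • v) * fderiv ℝ k q (Complex.I • L q))) W' :=
      (h.smooth.mul (h.smooth_realLevi hkW v)).add (contDiffOn_const.mul
        (((h.smooth.fderiv_apply_field h.isOpen contDiffOn_const).mul
          (hkW.fderiv_apply_field h.isOpen h.smooth_field)).add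
        ((h.smooth.fderiv_apply_field h.isOpen contDiffOn_const).mul
          (hkW.fderiv_apply_field h.isOpen h.smooth_field.I_smul))))
    refine (hcont hsm).abs.eventually (gt_mem_nhds ?_)
    simp [h.eq_zero, hdk]
  clear_value K
  have hev : ∀ᶠ q in 𝓝 p, q ∈ W' ∧ 0 < G q ∧
      ∀ ξ, 0 ≤ realLevi (fun x => r x * G x) q ξ ξ := by
    have hr8 : ∀ᶠ q in 𝓝 p, 2 * C * (K + 1) * |r q| < 1 / 8 :=
      ((hcont h.smooth).abs.const_mul (2 * C * (K + 1))).eventually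
        (gt_mem_nhds (by simp [h.eq_zero]))
    have hkK : ∀ᶠ q in 𝓝 p, |k q| < K + 1 :=
      (hcont hkW).abs.eventually (gt_mem_nhds (by simp only [hkp, abs_of_nonneg hK0]; linarith))
    have hγ' : ∀ᶠ q in 𝓝 p, 1 + C + 2 * C * (K + 1) < leviForm k L q :=
      (hcont (h.smooth_leviForm hkW)).eventually (lt_mem_nhds hγ)
    have hG0 : ∀ᶠ q in 𝓝 p, 0 < G q :=
      (hcont hGs).eventually (lt_mem_nhds (by simp [hG, h.eq_zero, hHp]))
    have hD : ∀ᶠ q in 𝓝 p, 32 * (C + 2) ^ 2 < realLevi (fun x => r x * G x) q u u :=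
      (hcont (hρ.realLevi_apply h.isOpen contDiffOn_const contDiffOn_const)).eventually
        (lt_mem_nhds hDp)
    filter_upwards [h.mem_nhds, hG0, hD, hγ', hkK, hr8, hεs u, hεs (Complex.I • u), hC₀, hC₁, hC₂,
      hC₃, hspan, hπ.eventually hlevi] with q hq hG0 hD hγ hk hr8 hε hε' hC₀ hC₁ hC₂ hC₃ hspan hl
    have hr2 := h.smooth.contDiffAt_two h.isOpen hq
    have hH2 := hH.contDiffAt_two h.isOpen hq
    have hk2 := hkW.contDiffAt_two h.isOpen hq
    have hexp := realLevi_mul_add_mul hr2 hH2 hk2 (h.tangent q hq) (h.tangent_I q hq)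
    have hA : realLevi (fun x => r x * G x) q (L q) (L q)
        = (r q * leviForm H L q + H q * leviForm r L q) + 2 * r q * k q * leviForm r L q
          + r q * (r q * leviForm k L q) := by
      rw [hexp, realLevi_mul hr2 hH2]
      simp only [h.tangent q hq, h.tangent_I q hq, leviForm]
      ring
    have hσ := Real.sq_sqrt hl
    have hσ0 := Real.sqrt_nonneg (leviForm r L (q - s q • u))
    rw [abs_of_nonneg hl, ← hσ] at hC₁
    rw [← hσ] at hC₀
    set σ := √(leviForm r L (q - s q • u))
    have hr0 := abs_nonneg (r q)
    have hCb : ∀ {c x t : ℝ}, 0 ≤ t → c ≤ C → x ≤ c * t → x ≤ C * t := fun ht hc hx =>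
      hx.trans (mul_le_mul_of_nonneg_right hc ht)
    have ha0 := le_abs_self C₀
    have ha1 := abs_nonneg C₀
    have hst : 0 ≤ σ + |r q| := by positivity
    have hfin := sq_add_sq_le_of_bounds hC0 hK0 hσ0 hA
      (by nlinarith [mul_le_mul_of_nonneg_right (show C₀ ≤ C by linarith) (sq_nonneg (r q))])
      (hCb (by positivity) (by linarith) hC₁) hk.le hr8.le hγ.le (hexp u)
      (hCb hst (by linarith) hC₂.1) (hCb hst (by linarith) hC₂.2) hε.le (hexp (Complex.I • u))
      (hCb hst (by linarith) hC₃.1) (hCb hst (by linarith) hC₃.2) hε'.le hD.le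
    refine ⟨hq, hG0, fun ξ => ?_⟩
    obtain ⟨a, b, rfl⟩ := hspan ξ
    exact realLevi_nonneg_of_sq_le (hρ.contDiffAt_two h.isOpen hq) hfin.1
      ((by positivity : (0 : ℝ) ≤ 32 * (C + 2) ^ 2).trans hD.le) hfin.2 a b
  obtain ⟨V, hV, hVo, hpV⟩ := _root_.eventually_nhds_iff.1 hev
  exact ⟨V, fun q hq => hW'W (hV q hq).1, hVo, hpV, G, hGs.mono fun q hq => (hV q hq).1,
    fun q hq => (hV q hq).2.1, fun q hq => (hV q hq).2.2⟩

end IsTangentFrame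

end Modification

/-! ### Local defining functions -/

section DefiningFunctions

lemma tendsto_add_smul_nhdsGT {E : Type*} [NormedAddCommGroup E] [NormedSpace ℝ E] (p u : E) :
    Tendsto (fun t : ℝ => p + t • u) (𝓝[>] 0) (𝓝 p) := by
  have : ContinuousAt (fun t : ℝ => p + t • u) 0 := by fun_prop
  have h2 : Tendsto (fun t : ℝ => p + t • u) (𝓝 0) (𝓝 p) := by simpa [ContinuousAt] using this
  exact h2.mono_left nhdsWithin_le_nhds

namespace IsLocalDefiningFunction

variable {n : ℕ} {Ω U : Set (CSpace n)} {p : CSpace n} {r : CSpace n → ℝ}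

lemma eq_zero (h : IsLocalDefiningFunction Ω p U r) (hΩ : IsOpen Ω) {q : CSpace n} (hq : q ∈ U)
    (hqΩ : q ∈ frontier Ω) : r q = 0 := by
  rw [hΩ.frontier_eq] at hqΩ
  have hc : ContinuousAt r q := (h.smooth.contDiffAt_two h.isOpen hq).continuousAt
  refine le_antisymm ?_ (not_lt.1 fun hlt => hqΩ.2 ?_)
  · by_contra! hpos
    obtain ⟨x, ⟨hx, hxU⟩, hxΩ⟩ := mem_closure_iff_nhds.1 hqΩ.1 _
      (Filter.inter_mem (hc.eventually (lt_mem_nhds hpos)) (h.isOpen.mem_nhds hq))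
    have : x ∈ Ω ∩ U := ⟨hxΩ, hxU⟩
    rw [h.inter_eq] at this
    exact lt_asymm hx this.2
  · have : q ∈ {q ∈ U | r q < 0} := ⟨hq, hlt⟩
    rw [← h.inter_eq] at this
    exact this.1

lemma mem_frontier (h : IsLocalDefiningFunction Ω p U r) {q : CSpace n} (hq : q ∈ U)
    (hr : r q = 0) (hdr : fderiv ℝ r q ≠ 0) : q ∈ frontier Ω := by
  have hqΩ : q ∉ Ω := fun hqΩ => by
    have : q ∈ Ω ∩ U := ⟨hqΩ, hq⟩
    rw [h.inter_eq] at this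
    exact this.2.ne hr
  refine ⟨?_, fun hint => hqΩ (interior_subset hint)⟩
  obtain ⟨u, hu⟩ := exists_fderiv_pos (neg_ne_zero.2 hdr)
  have hd := (h.smooth.contDiffAt_two h.isOpen hq).differentiableAt (by simp)
  have hev := eventually_pos_of_fderiv_pos (r := fun x => -r x) (u := u) hd.fun_neg (by simp [hr])
    (by rw [fderiv_fun_neg]; exact hu)
  have hlim := tendsto_add_smul_nhdsGT q u
  refine mem_closure_of_tendsto hlim ?_
  filter_upwards [hev, hlim.eventually (h.isOpen.mem_nhds hq)] with t ht htU
  have : q + t • u ∈ {q ∈ U | r q < 0} := ⟨htU, by linarith⟩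
  rw [← h.inter_eq] at this
  exact this.1

lemma nhdsWithin_frontier (h : IsLocalDefiningFunction Ω p U r) (hΩ : IsOpen Ω)
    (hp : p ∈ frontier Ω) : 𝓝[frontier Ω] p = 𝓝[{q | r q = 0}] p := by
  rw [nhdsWithin_eq_iff_eventuallyEq]
  have hd : ContinuousAt (fderiv ℝ r) p :=
    ((h.smooth.contDiffAt_two h.isOpen h.mem).fderiv_right (m := 1) (by norm_num)).continuousAt
  filter_upwards [h.isOpen.mem_nhds h.mem, hd.eventually_ne (h.fderiv_ne_zero p ⟨hp, h.mem⟩)]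
    with q hq hdq
  exact propext ⟨fun hqΩ => h.eq_zero hΩ hq hqΩ, fun hr => h.mem_frontier hq hr hdq⟩

lemma mul_pos (h : IsLocalDefiningFunction Ω p U r) (hΩ : IsOpen Ω) {V : Set (CSpace n)}
    {H : CSpace n → ℝ} (hVU : V ⊆ U) (hV : IsOpen V) (hpV : p ∈ V) (hH : ContDiffOn ℝ ∞ H V)
    (hpos : ∀ q ∈ V, 0 < H q) : IsLocalDefiningFunction Ω p V fun q => r q * H q where
  isOpen := hV
  mem := hpV
  smooth := (h.smooth.mono hVU).mul hH
  inter_eq := by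
    ext q
    have : q ∈ Ω ∩ U ↔ q ∈ {q ∈ U | r q < 0} := by rw [h.inter_eq]
    simp only [Set.mem_inter_iff, Set.mem_ofPred_eq] at this ⊢
    constructor
    · rintro ⟨hq, hqV⟩
      exact ⟨hqV, mul_neg_of_neg_of_pos (this.1 ⟨hq, hVU hqV⟩).2 (hpos q hqV)⟩
    · rintro ⟨hqV, hq⟩
      exact ⟨(this.2 ⟨hVU hqV, neg_of_mul_neg_left hq (hpos q hqV).le⟩).1, hqV⟩
  fderiv_ne_zero := fun q ⟨hqΩ, hqV⟩ => by
    rw [fderiv_fun_mul ((h.smooth.contDiffAt_two h.isOpen (hVU hqV)).differentiableAt (by simp))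
      ((hH.contDiffAt_two hV hqV).differentiableAt (by simp)), h.eq_zero hΩ (hVU hqV) hqΩ, zero_smul,
      zero_add]
    exact smul_ne_zero (hpos q hqV).ne' (h.fderiv_ne_zero q ⟨hqΩ, hVU hqV⟩)

/-- A direction pointing out of the domain with respect to one defining function does so with respect
to any other one. -/
lemma fderiv_nonneg {U' : Set (CSpace n)} {r' : CSpace n → ℝ}
    (h : IsLocalDefiningFunction Ω p U r) (h' : IsLocalDefiningFunction Ω p U' r') (hΩ : IsOpen Ω)
    (hp : p ∈ frontier Ω) {u : CSpace n} (hu : 0 < fderiv ℝ r p u) : 0 ≤ fderiv ℝ r' p u := by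
  by_contra! hneg
  have hd := (h.smooth.contDiffAt_two h.isOpen h.mem).differentiableAt (by simp)
  have hd' := (h'.smooth.contDiffAt_two h'.isOpen h'.mem).differentiableAt (by simp)
  have h1 := eventually_pos_of_fderiv_pos hd (h.eq_zero hΩ h.mem hp) hu
  have h2 := eventually_pos_of_fderiv_pos (r := fun x => -r' x) (u := u) hd'.fun_neg
    (by simp [h'.eq_zero hΩ h'.mem hp]) (by rw [fderiv_fun_neg]; simpa using hneg)
  have hlim := tendsto_add_smul_nhdsGT p u
  obtain ⟨t, h1, h2, h3, h4⟩ := (h1.and (h2.and ((hlim.eventually (h.isOpen.mem_nhds h.mem)).and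
    (hlim.eventually (h'.isOpen.mem_nhds h'.mem))))).exists
  have h5 : p + t • u ∈ {q ∈ U' | r' q < 0} := ⟨h4, by linarith⟩
  rw [← h'.inter_eq] at h5
  have h6 : p + t • u ∈ Ω ∩ U := ⟨h5.1, h3⟩
  rw [h.inter_eq] at h6
  exact lt_asymm h1 h6.2

end IsLocalDefiningFunction

end DefiningFunctions

/-! ### Comparison of defining functions, and derivatives along tangential fields -/

section Comparison

variable {E : Type*} [NormedAddCommGroup E] [NormedSpace ℝ E]

lemma hasFDerivAt_fderiv_apply {f : E → ℝ} {Y : E → E} {p : E} (hf : ContDiffAt ℝ 2 f p)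
    (hY : ContDiffAt ℝ 2 Y p) :
    HasFDerivAt (fun x => fderiv ℝ f x (Y x))
      ((fderiv ℝ f p) ∘L fderiv ℝ Y p + (fderiv ℝ (fderiv ℝ f) p).flip (Y p)) p :=
  (((hf.fderiv_right (m := 1) (by norm_num)).differentiableAt (by simp)).hasFDerivAt).clm_apply
    (hY.differentiableAt (by simp)).hasFDerivAt

variable [CompleteSpace E]

lemma fderiv_eq_smul_of_eq_zero_on_zeros {r f : E → ℝ} {p u : E}
    (hr : ContDiffAt ℝ 1 r p) (hf : ContDiffAt ℝ 1 f p) (h0 : r p = 0) (hu : fderiv ℝ r p u ≠ 0)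
    (hf0 : f p = 0) (hpos : ∀ᶠ q in 𝓝 p, r q = 0 → 0 ≤ f q) :
    fderiv ℝ f p = (fderiv ℝ f p u / fderiv ℝ r p u) • fderiv ℝ r p := by
  ext v
  have hdr : fderiv ℝ r p ≠ 0 := fun h => hu (by rw [h]; rfl)
  have h1 := fderiv_eq_zero_of_nonneg_on_zeros hr hf h0 hdr hf0 hpos
    (v := v - (fderiv ℝ r p v / fderiv ℝ r p u) • u) (by
      rw [map_sub, map_smul, smul_eq_mul, div_mul_cancel₀ _ hu, sub_self])
  rw [map_sub, map_smul, sub_eq_zero] at h1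
  rw [h1]
  simp only [smul_apply, smul_eq_mul]
  ring

variable [NormedSpace ℂ E]

/-- The complex Hessians of two functions with proportional gradients on the zero set are
proportional on complex tangential directions. -/
lemma realLevi_eq_mul_of_fderiv_eq {r r' h : E → ℝ} {q X : E} (hr : ContDiffAt ℝ 2 r q)
    (hr' : ContDiffAt ℝ 2 r' q) (hh : ContDiffAt ℝ 1 h q) (hq : r q = 0)
    (hdr : fderiv ℝ r q ≠ 0)
    (hd : ∀ᶠ x in 𝓝 q, r x = 0 → fderiv ℝ r' x = h x • fderiv ℝ r x)
    (hX : fderiv ℝ r q X = 0) (hIX : fderiv ℝ r q (Complex.I • X) = 0) :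
    realLevi r' q X X = h q * realLevi r q X X := by
  have key : ∀ Y, fderiv ℝ r q Y = 0 →
      fderiv ℝ (fderiv ℝ r') q Y Y = h q * fderiv ℝ (fderiv ℝ r) q Y Y := fun Y hY => by
    have h1 : ContDiffAt ℝ 1 (fun x => fderiv ℝ r' x Y) q :=
      (hr'.fderiv_right (m := 1) (by norm_num)).clm_apply contDiffAt_const
    have h2 : ContDiffAt ℝ 1 (fun x => fderiv ℝ r x Y) q :=
      (hr.fderiv_right (m := 1) (by norm_num)).clm_apply contDiffAt_const
    have h3 := fderiv_eq_zero_of_eq_zero_on_zeros (hr.of_le (by norm_num))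
      (h1.sub (hh.mul h2)) hq hdr (hd.mono fun x hx hrx => by simp [hx hrx]) hY
    have h4 := (hasFDerivAt_fderiv_apply hr' (contDiffAt_const (c := Y))).sub
      ((hh.differentiableAt (by simp)).hasFDerivAt.mul
        (hasFDerivAt_fderiv_apply hr (contDiffAt_const (c := Y))))
    have h5 := h4.fderiv ▸ h3
    simp [hY] at h5
    linarith
  rw [realLevi, realLevi, key X hX, key _ hIX]
  ring

/-- If `F` has a minimum at `p` on the zero set of `r`, and if the complex Hessians of `F` and `r`
vanish at `p` in the complex tangential direction `X`, then all second derivatives of `F` along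
tangential fields with values `X` and `i X` at `p` vanish. -/
lemma fderiv_fderiv_apply_eq_zero [IsScalarTower ℝ ℂ E] {r F : E → ℝ} {p u X : E}
    (hr : ContDiffAt ℝ 2 r p) (hF : ContDiffAt ℝ 2 F p) (h0 : r p = 0) (hu : fderiv ℝ r p u ≠ 0)
    (hF0 : F p = 0) (hpos : ∀ᶠ q in 𝓝 p, r q = 0 → 0 ≤ F q)
    (hX : fderiv ℝ r p X = 0) (hIX : fderiv ℝ r p (Complex.I • X) = 0)
    (hrX : realLevi r p X X = 0) (hFX : realLevi F p X X = 0) {Y : E → E}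
    (hY : ContDiffAt ℝ 2 Y p) (hrY : ∀ᶠ q in 𝓝 p, r q = 0 → fderiv ℝ r q (Y q) = 0)
    {Z : E} (hZ : Z = X ∨ Z = Complex.I • X) (hYp : Y p = X ∨ Y p = Complex.I • X) :
    fderiv ℝ (fun q => fderiv ℝ F q (Y q)) p Z = 0 := by
  have hdr : fderiv ℝ r p ≠ 0 := fun h => hu (by rw [h]; rfl)
  set c : ℝ := fderiv ℝ F p u / fderiv ℝ r p u with hc
  have hdF : fderiv ℝ F p = c • fderiv ℝ r p := fderiv_eq_smul_of_eq_zero_on_zeros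
    (hr.of_le (by norm_num)) (hF.of_le (by norm_num)) h0 hu hF0 hpos
  have hcr : ContDiffAt ℝ 2 (fun x => -c * r x) p := contDiffAt_const.mul hr
  have hG : ContDiffAt ℝ 2 (fun x => F x + -c * r x) p := hF.add hcr
  have hdcr : (fderiv ℝ fun x => -c * r x) =ᶠ[𝓝 p] fun x => -c • fderiv ℝ r x := by
    filter_upwards [hr.eventually (by simp)] with x hx
    exact fderiv_const_mul (hx.differentiableAt (by simp)) _
  have hd2 : fderiv ℝ (fderiv ℝ fun x => F x + -c * r x) p
      = fderiv ℝ (fderiv ℝ F) p - c • fderiv ℝ (fderiv ℝ r) p := by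
    rw [fderiv_fderiv_add hF hcr, hdcr.fderiv_eq, fderiv_fun_const_smul
      ((hr.fderiv_right (m := 1) (by norm_num)).differentiableAt (by simp)), neg_smul,
      sub_eq_add_neg]
  have hnn : ∀ v, fderiv ℝ r p v = 0 →
      0 ≤ (fderiv ℝ (fderiv ℝ F) p - c • fderiv ℝ (fderiv ℝ r) p) v v := fun v hv => by
    rw [← hd2]
    refine fderiv_fderiv_nonneg_of_nonneg_on_zeros hr hG h0 hdr (by simp [hF0, h0]) ?_ ?_ hv
    · rw [fderiv_fun_add (hF.differentiableAt (by simp)) (hcr.differentiableAt (by simp)), hdF,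
        hdcr.self_of_nhds]
      simp
    · filter_upwards [hpos] with q hq hrq
      simpa [hrq] using hq hrq
  set B := fderiv ℝ (fderiv ℝ F) p - c • fderiv ℝ (fderiv ℝ r) p with hB
  have hsymm : ∀ v w, B v w = B w v := fun v w => by
    have h1 := (hF.isSymmSndFDerivAt (by simp)).eq v w
    have h2 := (hr.isSymmSndFDerivAt (by simp)).eq v w
    simp [hB, h1, h2]
  have htr : B X X + B (Complex.I • X) (Complex.I • X) = 0 := by
    have e : B X X + B (Complex.I • X) (Complex.I • X)
        = realLevi F p X X - c * realLevi r p X X := by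
      simp [hB, realLevi]; ring
    rw [e, hFX, hrX]; ring
  have hXX : B X X = 0 := by linarith [hnn X hX, hnn _ hIX]
  have hII : B (Complex.I • X) (Complex.I • X) = 0 := by linarith
  have hXI : B X (Complex.I • X) = 0 := by
    have h1 := hnn (X + Complex.I • X) (by rw [map_add, hX, hIX, add_zero])
    have h2 := hnn (X - Complex.I • X) (by rw [map_sub, hX, hIX, sub_zero])
    simp only [map_add, map_sub, add_apply, sub_apply, hXX, hII, hsymm (Complex.I • X) X] at h1 h2
    linarith
  have hBZ : B Z (Y p) = 0 := by
    rcases hZ with rfl | rfl <;> rcases hYp with h | h <;> rw [h]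
    · exact hXX
    · exact hXI
    · rw [hsymm, hXI]
    · exact hII
  have hrZ : fderiv ℝ r p Z = 0 := by rcases hZ with rfl | rfl <;> assumption
  have h1 := fderiv_eq_zero_of_eq_zero_on_zeros (hr.of_le (by norm_num))
    (f := fun q => fderiv ℝ r q (Y q))
    ((hr.fderiv_right (m := 1) (by norm_num)).clm_apply (hY.of_le (by norm_num))) h0 hdr hrY hrZ
  rw [(hasFDerivAt_fderiv_apply hr hY).fderiv] at h1
  rw [(hasFDerivAt_fderiv_apply hF hY).fderiv]
  simp only [hdF, hB, add_apply, sub_apply, smul_apply, ContinuousLinearMap.comp_apply,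
    ContinuousLinearMap.flip_apply, smul_eq_mul] at h1 hBZ ⊢
  linear_combination hBZ + c * h1

end Comparison

/-! ### Complex tangential fields and the type condition -/
lemma delPairing_smul {r : CSpace 2 → ℝ} {q : CSpace 2} (a : ℂ) (ξ : CSpace 2) :
    delPairing r q (a • ξ) = a * delPairing r q ξ := by
  simp only [delPairing, Fin.sum_univ_two, PiLp.smul_apply, smul_eq_mul]; ring

lemma delPairing_sub {r : CSpace 2 → ℝ} {q : CSpace 2} (ξ η : CSpace 2) :
    delPairing r q (ξ - η) = delPairing r q ξ - delPairing r q η := by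
  simp only [delPairing, Fin.sum_univ_two, PiLp.sub_apply]; ring

lemma delPairing_eq_zero_iff {r : CSpace 2 → ℝ} {q : CSpace 2} (hr : DifferentiableAt ℝ r q)
    (ξ : CSpace 2) : delPairing r q ξ = 0 ↔
      fderiv ℝ r q ξ = 0 ∧ fderiv ℝ r q (Complex.I • ξ) = 0 := by
  rw [delPairing_eq hr, Complex.ext_iff]
  simp

lemma contDiffOn_delPairing {r : CSpace 2 → ℝ} {X : CSpace 2 → CSpace 2} {W : Set (CSpace 2)}
    (hW : IsOpen W) (hr : ContDiffOn ℝ ∞ r W) (hX : ContDiffOn ℝ ∞ X W) :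
    ContDiffOn ℝ ∞ (fun q => delPairing r q (X q)) W := by
  have h1 := Complex.ofRealCLM.contDiff.comp_contDiffOn (hr.fderiv_apply_field hW hX)
  have h2 := Complex.ofRealCLM.contDiff.comp_contDiffOn (hr.fderiv_apply_field hW hX.I_smul)
  refine (contDiffOn_const (c := (1 / 2 : ℂ)) |>.mul
    (h1.sub (contDiffOn_const (c := Complex.I) |>.mul h2))).congr fun q hq => ?_
  rw [delPairing_eq ((hr.contDiffAt_two hW hq).differentiableAt (by simp))]
  rfl

/-- A complex tangential vector `X` and a vector `Y` that is not complex tangential are linearly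
independent. -/
lemma det_ne_zero_of_delPairing {r : CSpace 2 → ℝ} {q X Y : CSpace 2} (hX0 : X ≠ 0)
    (hX : delPairing r q X = 0) (hY : delPairing r q Y ≠ 0) : X 0 * Y 1 - X 1 * Y 0 ≠ 0 := by
  intro hdet
  have h1 : ∀ i j, X i * Y j = Y i * X j := by
    intro i j
    fin_cases i <;> fin_cases j <;> simp only [Fin.zero_eta, Fin.mk_one]
    · exact mul_comm _ _
    · linear_combination hdet
    · linear_combination -hdet
    · exact mul_comm _ _
  have h2 : ∀ i, X i = 0 := fun i => by
    have e : X i • Y = Y i • X := by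
      ext j
      exact h1 i j
    have h3 := congrArg (delPairing r q) e
    rw [delPairing_smul, delPairing_smul, hX, mul_zero] at h3
    exact (mul_eq_zero.1 h3).resolve_right hY
  exact hX0 (by ext i; exact h2 i)

lemma exists_eq_smul_add_smul {X Y : CSpace 2} (hdet : X 0 * Y 1 - X 1 * Y 0 ≠ 0) (ξ : CSpace 2) :
    ∃ a b : ℂ, ξ = a • X + b • Y := by
  refine ⟨(ξ 0 * Y 1 - ξ 1 * Y 0) / (X 0 * Y 1 - X 1 * Y 0),
    (X 0 * ξ 1 - X 1 * ξ 0) / (X 0 * Y 1 - X 1 * Y 0), ?_⟩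
  ext i
  fin_cases i
  · simp only [Fin.zero_eta, PiLp.add_apply, PiLp.smul_apply, smul_eq_mul]
    rw [div_mul_eq_mul_div, div_mul_eq_mul_div, ← add_div, eq_div_iff hdet]
    ring
  · simp only [Fin.mk_one, PiLp.add_apply, PiLp.smul_apply, smul_eq_mul]
    rw [div_mul_eq_mul_div, div_mul_eq_mul_div, ← add_div, eq_div_iff hdet]
    ring

lemma fderiv_combination_eq_zero {f g : CSpace 2 → ℝ} {h : CSpace 2 → ℂ} {p Z : CSpace 2} {ε : ℂ}
    (hf : DifferentiableAt ℝ f p) (hg : DifferentiableAt ℝ g p)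
    (hh : h =ᶠ[𝓝 p] fun q => (1 / 2 : ℂ) * (f q + ε * g q))
    (hfZ : fderiv ℝ f p Z = 0) (hgZ : fderiv ℝ g p Z = 0) : fderiv ℝ h p Z = 0 := by
  have h1 := Complex.ofRealCLM.hasFDerivAt.comp p hf.hasFDerivAt
  have h2 := Complex.ofRealCLM.hasFDerivAt.comp p hg.hasFDerivAt
  have h3 : HasFDerivAt h _ p :=
    ((h1.add (h2.const_mul ε)).const_mul (1 / 2 : ℂ)).congr_of_eventuallyEq hh
  rw [h3.fderiv]
  simp [hfZ, hgZ]

lemma applyWord_cons_eq_zero {L : CSpace 2 → CSpace 2} {p : CSpace 2} (a : Bool) (w : List Bool)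
    {f : CSpace 2 → ℂ} (h1 : fderiv ℝ (applyWord L w f) p (L p) = 0)
    (h2 : fderiv ℝ (applyWord L w f) p (Complex.I • L p) = 0) : applyWord L (a :: w) f p = 0 := by
  cases a
  · rw [applyWord, applyConjField_eq, h1, h2]; simp
  · rw [applyWord, applyField_eq, h1, h2]; simp

lemma applyWord_singleton_eq {L : CSpace 2 → CSpace 2} {q : CSpace 2} (a : Bool)
    {f : CSpace 2 → ℂ} {F : CSpace 2 → ℝ} (hf : f =ᶠ[𝓝 q] fun x => (F x : ℂ))
    (hF : DifferentiableAt ℝ F q) :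
    applyWord L [a] f q = (1 / 2 : ℂ) * ((fderiv ℝ F q (L q) : ℝ)
      + (if a then -Complex.I else Complex.I) * (fderiv ℝ F q (Complex.I • L q) : ℝ)) := by
  cases a
  · rw [applyWord, applyConjField_eq, applyWord, hf.fderiv_eq, fderiv_ofReal hF, fderiv_ofReal hF]
    simp
  · rw [applyWord, applyField_eq, applyWord, hf.fderiv_eq, fderiv_ofReal hF, fderiv_ofReal hF]
    simp [sub_eq_add_neg]

theorem theoremT (Ω : Set (CSpace 2)) (hΩ : IsSmoothlyBoundedDomain Ω)
    (hpsc : IsPseudoconvex Ω) (p₀ : CSpace 2) (hp₀ : p₀ ∈ frontier Ω)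
    (htype : HasType Ω p₀ 4)
    (hbdry : ∃ U r, IsLocalDefiningFunction Ω p₀ U r ∧ IsPshOnBoundaryNear Ω p₀ r) :
    ∃ U r, IsLocalDefiningFunction Ω p₀ U r ∧ IsPshOn r U := by
  obtain ⟨U, r, hr, hpsh⟩ := hbdry
  obtain ⟨U', r', L', hr', hL', hne, ⟨w, hw, hwne⟩, hlow⟩ := htype
  have hΩo := hΩ.isOpen
  have hr2 := hr.smooth.contDiffAt_two hr.isOpen hr.mem
  have hrp := hr.eq_zero hΩo hr.mem hp₀
  obtain ⟨u, hu⟩ := exists_fderiv_pos (hr.fderiv_ne_zero p₀ ⟨hp₀, hr.mem⟩)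
  have hfr := hr.nhdsWithin_frontier hΩo hp₀
  -- The quotient of the gradients of the two defining functions at boundary points.
  set h : CSpace 2 → ℝ := fun q => fderiv ℝ r' q u / fderiv ℝ r q u
  have hev : ∀ᶠ q in 𝓝 p₀, q ∈ U ∧ q ∈ U' ∧ 0 < fderiv ℝ r q u ∧
      (q ∈ frontier Ω ↔ q ∈ {q | r q = 0}) := by
    have hd : ContinuousAt (fun q => fderiv ℝ r q u) p₀ :=
      ((hr2.fderiv_right (m := 1) (by norm_num)).continuousAt).clm_apply continuousAt_const
    exact Eventually.and (hr.isOpen.mem_nhds hr.mem) (Eventually.and (hr'.isOpen.mem_nhds hr'.mem)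
      ((hd.eventually (lt_mem_nhds hu)).and
      ((nhdsWithin_eq_iff_eventuallyEq.1 hfr).mono fun q hq => iff_of_eq hq)))
  obtain ⟨W, hW, hWo, hpW⟩ := _root_.eventually_nhds_iff.1 hev
  have hrW : ContDiffOn ℝ ∞ r W := hr.smooth.mono fun q hq => (hW q hq).1
  have hr'W : ContDiffOn ℝ ∞ r' W := hr'.smooth.mono fun q hq => (hW q hq).2.1
  have hL'W : ContDiffOn ℝ ∞ L' W := hL'.smooth.mono fun q hq => (hW q hq).2.1
  have hdiff : ∀ {q}, q ∈ W → DifferentiableAt ℝ r q := fun hq =>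
    (hrW.contDiffAt_two hWo hq).differentiableAt (by simp)
  have hhW : ContDiffOn ℝ ∞ h W :=
    (hr'W.fderiv_apply_field hWo contDiffOn_const).div
      (hrW.fderiv_apply_field hWo contDiffOn_const) fun q hq => (hW q hq).2.2.1.ne'
  have hdr' : ∀ q ∈ W, r q = 0 → fderiv ℝ r' q = h q • fderiv ℝ r q := fun q hq hq0 =>
    fderiv_eq_smul_of_eq_zero_on_zeros ((hrW.contDiffAt_two hWo hq).of_le (by norm_num))
      ((hr'W.contDiffAt_two hWo hq).of_le (by norm_num)) hq0 (hW q hq).2.2.1.ne'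
      (hr'.eq_zero hΩo (hW q hq).2.1 ((hW q hq).2.2.2.2 hq0))
      (by
        filter_upwards [hWo.mem_nhds hq] with x hx hx0
        exact (hr'.eq_zero hΩo (hW x hx).2.1 ((hW x hx).2.2.2.2 hx0)).ge)
  have hhp : 0 < h p₀ := by
    refine lt_of_le_of_ne (div_nonneg (hr.fderiv_nonneg hr' hΩo hp₀ hu) hu.le) fun h0 => ?_
    have := hdr' p₀ hpW hrp
    rw [← h0, zero_smul] at this
    exact hr'.fderiv_ne_zero p₀ ⟨hp₀, hr'.mem⟩ this
  have hdru : ∀ q ∈ W, delPairing r q u ≠ 0 := fun q hq h0 =>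
    (hW q hq).2.2.1.ne' ((delPairing_eq_zero_iff (hdiff hq) u).1 h0).1
  -- Correct `L'` to a field which is complex tangential to all level sets of `r`.
  set L : CSpace 2 → CSpace 2 := fun q => L' q - (delPairing r q (L' q) / delPairing r q u) • u
    with hL
  have hLW : ContDiffOn ℝ ∞ L W := by
    have h1 := (contDiffOn_delPairing hWo hrW (contDiffOn_const (c := u))).inv hdru
    have h2 := (contDiffOn_delPairing hWo hrW hL'W).mul h1
    exact (hL'W.sub (h2.smul (contDiffOn_const (c := u)))).congr fun q hq => by simp [hL, div_eq_mul_inv]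
  have hLt : ∀ q ∈ W, delPairing r q (L q) = 0 := fun q hq => by
    rw [hL, delPairing_sub, delPairing_smul, div_mul_cancel₀ _ (hdru q hq), sub_self]
  have hframe : IsTangentFrame r L u p₀ W := ⟨hWo, hpW, hrW, hLW, hrp, hu,
    fun q hq => ((delPairing_eq_zero_iff (hdiff hq) _).1 (hLt q hq)).1,
    fun q hq => ((delPairing_eq_zero_iff (hdiff hq) _).1 (hLt q hq)).2⟩
  have hWl : ∀ᶠ q in 𝓝[{q | r q = 0}] p₀, q ∈ W ∧ r q = 0 ∧ 0 < h q :=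
    Eventually.and (nhdsWithin_le_nhds hframe.mem_nhds) (Eventually.and self_mem_nhdsWithin
      (nhdsWithin_le_nhds ((hhW.contDiffAt_two hWo hpW).continuousAt.eventually
        (lt_mem_nhds hhp))))
  have hL'0 : ∀ q ∈ W, r q = 0 → 0 < h q → delPairing r q (L' q) = 0 := fun q hq hq0 hhq => by
    have h1 := hL'.tangential q ⟨(hW q hq).2.2.2.2 hq0, (hW q hq).2.1⟩
    rw [delPairing_eq_zero_iff ((hr'W.contDiffAt_two hWo hq).differentiableAt (by simp)),
      hdr' q hq hq0] at h1
    rw [delPairing_eq_zero_iff (hdiff hq)]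
    simpa [hhq.ne'] using h1
  have hLL' : ∀ q ∈ W, r q = 0 → 0 < h q → L q = L' q := fun q hq hq0 hhq => by
    simp [hL, hL'0 q hq hq0 hhq]
  set F : CSpace 2 → ℝ := fun q => realLevi r' q (L' q) (L' q) / 4 with hF
  have hFW : ContDiffOn ℝ ∞ F W := (hr'W.realLevi_apply hWo hL'W hL'W).div_const 4
  have hFc : ∀ q ∈ W, complexHessian r' q (L' q) (L' q) = F q := fun q hq =>
    complexHessian_self (hr'W.contDiffAt_two hWo hq) _
  have hFlevi : ∀ q ∈ W, r q = 0 → 0 < h q → F q = h q / 4 * leviForm r L q :=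
    fun q hq hq0 hhq => by
      have := realLevi_eq_mul_of_fderiv_eq (hrW.contDiffAt_two hWo hq) (hr'W.contDiffAt_two hWo hq)
        ((hhW.contDiffAt_two hWo hq).of_le (by norm_num)) hq0
        (fun h0 => (hW q hq).2.2.1.ne' (by rw [h0]; rfl))
        (eventually_of_mem (hWo.mem_nhds hq) hdr') (hframe.tangent q hq)
        (hframe.tangent_I q hq)
      rw [leviForm, hF]
      simp only
      rw [← hLL' q hq hq0 hhq, this]
      ring
  have hpsh' : ∀ᶠ q in 𝓝[{q | r q = 0}] p₀, ∀ ξ, 0 ≤ realLevi r q ξ ξ := by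
    rw [IsPshOnBoundaryNear, hfr] at hpsh
    filter_upwards [hpsh, hWl] with q hq hqW
    exact (isPshAtPoint_iff (hrW.contDiffAt_two hWo hqW.1)).1 hq
  have hF0 : ∀ᶠ q in 𝓝[{q | r q = 0}] p₀, 0 ≤ F q := by
    filter_upwards [hpsh', hWl] with q hq hqW
    rw [hFlevi q hqW.1 hqW.2.1 hqW.2.2]
    exact mul_nonneg (by linarith [hqW.2.2]) (hq _)
  have hFp : F p₀ = 0 := by
    have := hlow [] (by simp)
    rw [applyWord, hFc p₀ hpW] at this
    exact_mod_cast this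
  have hFO : F =O[𝓝[{q | r q = 0}] p₀] leviForm r L := by
    have h1 := (hframe.isBigO_one (hhW.div_const 4)).mul
      (isBigO_refl (leviForm r L) (𝓝[{q | r q = 0}] p₀))
    simp only [one_mul] at h1
    refine h1.congr' (hWl.mono fun q hq => ?_) EventuallyEq.rfl
    rw [hFlevi q hq.1 hq.2.1 hq.2.2]
  have hLp := hLL' p₀ hpW hrp hhp
  have hLp0 : L p₀ ≠ 0 := hLp ▸ hne p₀ hr'.mem
  -- If the complex Hessian of `F` vanished in the direction `L p₀`, the type would exceed four.
  have hκ : leviForm F L p₀ ≠ 0 := fun hκ => by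
    have hlevi0 : realLevi r p₀ (L p₀) (L p₀) = 0 := by
      have := hFlevi p₀ hpW hrp hhp
      rw [hFp] at this
      exact (mul_eq_zero.1 this.symm).resolve_left (by positivity)
    have hpos := eventually_nhdsWithin_iff.1 hF0
    have hF2 := hFW.contDiffAt_two hWo hpW
    have hwl := eventually_nhdsWithin_iff.1 hWl
    have hzero : ∀ {Z : CSpace 2}, Z = L p₀ ∨ Z = Complex.I • L p₀ →
        fderiv ℝ (fun q => fderiv ℝ F q (L' q)) p₀ Z = 0 ∧
        fderiv ℝ (fun q => fderiv ℝ F q (Complex.I • L' q)) p₀ Z = 0 := fun hZ => by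
      constructor
      · refine fderiv_fderiv_apply_eq_zero hr2 hF2 hrp hu.ne' hFp hpos (hframe.tangent _ hpW)
          (hframe.tangent_I _ hpW) hlevi0 hκ (hL'W.contDiffAt_two hWo hpW) ?_ hZ (Or.inl hLp.symm)
        filter_upwards [hwl] with q hq hq0
        have := hq hq0
        exact ((delPairing_eq_zero_iff (hdiff this.1) _).1 (hL'0 q this.1 hq0 this.2.2)).1
      · refine fderiv_fderiv_apply_eq_zero hr2 hF2 hrp hu.ne' hFp hpos (hframe.tangent _ hpW)
          (hframe.tangent_I _ hpW) hlevi0 hκ (hL'W.I_smul.contDiffAt_two hWo hpW) ?_ hZ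
          (Or.inr (by rw [hLp]))
        filter_upwards [hwl] with q hq hq0
        have := hq hq0
        exact ((delPairing_eq_zero_iff (hdiff this.1) _).1 (hL'0 q this.1 hq0 this.2.2)).2
    obtain ⟨a, b, rfl⟩ : ∃ a b, w = [a, b] := List.length_eq_two.1 (by omega)
    have hb : applyWord L' [b] (fun q => complexHessian r' q (L' q) (L' q)) =ᶠ[𝓝 p₀]
        fun q => (1 / 2 : ℂ) * ((fderiv ℝ F q (L' q) : ℝ)
          + (if b then -Complex.I else Complex.I) * (fderiv ℝ F q (Complex.I • L' q) : ℝ)) := by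
      filter_upwards [hWo.mem_nhds hpW] with q hq
      exact applyWord_singleton_eq b (eventually_of_mem (hWo.mem_nhds hq) hFc)
        ((hFW.contDiffAt_two hWo hq).differentiableAt (by simp))
    have hd1 : DifferentiableAt ℝ (fun q => fderiv ℝ F q (L' q)) p₀ :=
      (hasFDerivAt_fderiv_apply hF2 (hL'W.contDiffAt_two hWo hpW)).differentiableAt
    have hd2 : DifferentiableAt ℝ (fun q => fderiv ℝ F q (Complex.I • L' q)) p₀ :=
      (hasFDerivAt_fderiv_apply hF2 (hL'W.I_smul.contDiffAt_two hWo hpW)).differentiableAt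
    refine hwne (applyWord_cons_eq_zero a [b] ?_ ?_) <;> rw [← hLp]
    · exact fderiv_combination_eq_zero hd1 hd2 hb (hzero (Or.inl rfl)).1 (hzero (Or.inl rfl)).2
    · exact fderiv_combination_eq_zero hd1 hd2 hb (hzero (Or.inr rfl)).1 (hzero (Or.inr rfl)).2
  have hspan : ∀ᶠ q in 𝓝 p₀, ∀ ξ, ∃ a b : ℂ, ξ = a • L q + b • u := by
    have hLc : ContinuousAt L p₀ := (hLW.contDiffAt_two hWo hpW).continuousAt
    have hc : ContinuousAt (fun q => L q 0 * u 1 - L q 1 * u 0) p₀ := by fun_prop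
    filter_upwards [hc.eventually_ne
      (det_ne_zero_of_delPairing hLp0 (hLt p₀ hpW) (hdru p₀ hpW))] with q hq
    exact exists_eq_smul_add_smul hq
  obtain ⟨V, hVW, hVo, hpV, H, hH, hHpos, hfin⟩ :=
    hframe.exists_psh_multiple hFW hpsh' hF0 hFp hFO hκ hspan
  refine ⟨V, fun q => r q * H q, hr.mul_pos hΩo (fun q hq => (hW q (hVW hq)).1) hVo hpV hH hHpos,
    fun q hq => ?_⟩
  exact (isPshAtPoint_iff (((hrW.mono hVW).mul hH).contDiffAt_two hVo hq)).2 (hfin q hq)
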